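/- **Setting.** The Bloch vector of a qubit operator $A$ is $(\mathrm{Tr}[XA],\mathrm{Tr}[YA],\mathrm{Tr}[ZA])$. Given source density matrices $\rho_1,\rho_2$ and pure target states $\bar\rho_1,\bar\rho_2$ of a qubit, taken with equal priorities $\pi_1=\pi_2=\tfrac12$, the average fidelity of a completely positive trace preserving (CPTP) map $\mathcal C$ is $$\mathcal F(\mathcal C)=\tfrac12\mathrm{Tr}[\mathcal C(\rho_1)\bar\rho_1]+\tfrac12\mathrm{Tr}[\mathcal C(\rho_2)\bar\rho_2].$$ A CPTP map is called optimal if it maximizes $\mathcal F$ over all CPTP maps. Let $\mathbf R_i$ and $\bar{\mathbf R}_i$ be the Bloch vectors of $\rho_i$ and $\tfrac12\bar\rho_i$, and put $\mathbf R_-=\mathbf R_1-\mathbf R_2$, $R_-=\|\mathbf R_-\|$, $R_\times=\|\mathbf R_1\times\mathbf R_2\|$, $\bar R_\times=\|\bar{\mathbf R}_1\times\bar{\mathbf R}_2\|$, $\bar R_+=\|\bar{\mathbf R}_1+\bar{\mathbf R}_2\|$, $$T=\sum_{i,j=1}^2(1-\mathbf R_i\cdot\mathbf R_j)(\bar{\mathbf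 R}_i\cdot\bar{\mathbf R}_j),\quad S=\sqrt{T^2+4\bar R_\times^2(R_-^2-R_\times^2)},\quad \Omega=S+T-2\bar R_\times R_\times .$$ **Procedure A** (for $\Omega>0$) is the map $\mathcal C(\varsigma)=U\,\mathcal D(V\varsigma V^\dagger)\,U^\dagger$ with $U,V$ unitary, where $V$ takes $\mathbf R_i$ to $\mathbf R_i'=\frac{R_\times}{R_-}\mathbf x+\frac{\mathbf R_i\cdot\mathbf R_-}{R_-}\mathbf z$; the linear trace preserving map $\mathcal D$ acts on Bloch vectors of states by $(x,y,z)\mapsto(s_1+\mu_1x,\mu_2y,\mu_3z)$ with $$\mu_2=\tfrac{2\bar R_\times R_\times}{S+T},\quad \mu_3=\sqrt{\tfrac{2}{S(S+T)}}\,\bar R_\times R_-,\quad \mu_1=2\sqrt{\tfrac{2}{S(S+T)^3}}\,\bar R_\times^2R_\times R_-,\quad s_1=\tfrac{(S+T)^2-4\bar R_\times^2R_\times^2}{\sqrt{2S(S+T)^3}};$$ and $U$ takes the resulting Bloch vectors to $k_{i1}\bar{\mathbf R}_1+k_{i2}\bar{\mathbf R}_2$, where, with $\alpha=\sqrt{\frac{S+T}{2S}}$,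 $\beta_i=\sqrt{\frac{2}{S(S+T)}}\,\mathbf R_i\cdot\mathbf R_-$, $\tilde1=2$, $\tilde2=1$, $$k_{ij}=\tfrac1\Gamma\left[\alpha^2+\beta_i\beta_j\bar R_\times^2+(-1)^{i+j}\alpha(\beta_1-\beta_2)\,\bar{\mathbf R}_{\tilde i}\cdot\bar{\mathbf R}_{\tilde j}\right],$$ $$\Gamma=\sqrt{\alpha^2\bar R_+^2+\left[\|\beta_1\bar{\mathbf R}_1+\beta_2\bar{\mathbf R}_2\|^2+2\alpha(\beta_1-\beta_2)\right]\bar R_\times^2}.$$ **(1) Mixed sources, pure targets.** Let $0<R<1$, $\theta\in(0,\pi/2]$, $\bar\theta\in[0,\pi/2]$. Suppose $\rho_1,\rho_2$ both have Bloch length $R$ and their Bloch vectors form the angle $2\theta$, and $\bar\rho_1,\bar\rho_2$ are pure with Bloch vectors forming the angle $2\bar\theta$. Then $$\Omega=2\left[\cos^2\bar\theta-R^2\cos\theta\cos\bar\theta\cos(\theta-\bar\theta)\right],$$ and the maximum of $\mathcal F$ over all CPTP maps exists and equals $$\begin{cases}\dfrac12+\dfrac12\sqrt{\cos^2\bar\theta+\dfrac{R^2\sin^2\theta\,\sin^2\bar\theta}{1-R^2\cos^2\theta}}&\text{if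 }\Omega>0,\\[2ex]\dfrac12+\dfrac12R\cos(\theta-\bar\theta)&\text{if }\Omega\le0.\end{cases}$$ If $\Omega>0$, a CPTP map implementing procedure A exists and every such map is optimal; if $\Omega\le0$, some unitary operation $\varsigma\mapsto W\varsigma W^\dagger$ is optimal. **(2) Stabilization against dephasing.** Let $\bar\theta\in(0,\pi/2)$, $p\in(0,1/2]$, $|\psi_{1}\rangle=\cos\frac{\bar\theta}2|+\rangle+\sin\frac{\bar\theta}2|-\rangle$, $|\psi_{2}\rangle=\cos\frac{\bar\theta}2|+\rangle-\sin\frac{\bar\theta}2|-\rangle$, with $|\pm\rangle=(|0\rangle\pm|1\rangle)/\sqrt2$. Take targets $\bar\rho_i=|\psi_i\rangle\langle\psi_i|$ and sources $\rho_i=p\,Z\bar\rho_iZ+(1-p)\bar\rho_i$, and let $R$ be the Bloch length of the sources. Then $\Omega=2\cos^2\bar\theta\,[1-R^2+2p\sin^2\bar\theta]>0$, the maximum of $\mathcal F$ over all CPTP maps exists and equals $$\frac12+\frac12\sqrt{\cos^2\bar\theta+\frac{\sin^4\bar\theta}{1-(1-2p)^2\cos^2\bar\theta}},$$ and procedure A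 is always optimal: a CPTP map implementing it exists, and every such map is optimal. -/

import Mathlib

open scoped ComplexOrder MatrixOrder Matrix.Norms.L2Operator CStarAlgebra Matrix

namespace QubitTracking

/-- Operators on a single qubit, in the computational basis. -/
abbrev Qubit : Type := Matrix (Fin 2) (Fin 2) ℂ

/-- Real 3-dimensional Euclidean space, in which Bloch vectors live. -/
abbrev E3 : Type := EuclideanSpace ℝ (Fin 3)

/-! ### States and Bloch vectors -/

/-- The Pauli matrix `X`. -/
def pauliX : Qubit := !![0, 1; 1, 0]

/-- The Pauli matrix `Y`. -/
def pauliY : Qubit := !![0, -Complex.I; Complex.I, 0]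

/-- The Pauli matrix `Z`. -/
def pauliZ : Qubit := !![1, 0; 0, -1]

/-- A qubit density matrix: positive semidefinite with unit trace. -/
structure IsDensity (ρ : Qubit) : Prop where
  posSemidef : ρ.PosSemidef
  trace_eq_one : ρ.trace = 1

/-- The operator `|ψ⟩⟨ψ|`. -/
def ketBra (ψ : Fin 2 → ℂ) : Qubit := Matrix.vecMulVec ψ (star ψ)

/-- A pure state: `|ψ⟩⟨ψ|` for a unit vector `ψ`. -/
def IsPureState (ρ : Qubit) : Prop :=
  ∃ ψ : Fin 2 → ℂ, star ψ ⬝ᵥ ψ = 1 ∧ ρ = ketBra ψ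

/-- The Bloch vector `(Tr[Xρ], Tr[Yρ], Tr[Zρ])` of a Hermitian operator. -/
noncomputable def bloch (ρ : Qubit) : E3 :=
  !₂[(pauliX * ρ).trace.re, (pauliY * ρ).trace.re, (pauliZ * ρ).trace.re]

/-! ### Quantum operations and the figure of merit -/

/-- The quantum operations on a qubit: completely positive trace preserving maps. -/
def cptp : Set (Qubit →CP Qubit) :=
  {C | ∀ A : Qubit, (C A).trace = A.trace}

/-- The average Hilbert--Schmidt inner product `∑ᵢ πᵢ Tr[C(ρᵢ) τᵢ]` between the outputs of `C` and
the targets; it is the average fidelity when the targets `τᵢ` are pure. -/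
noncomputable def avgFidelity (w : Fin 2 → ℝ) (ρ τ : Fin 2 → Qubit) (C : Qubit →CP Qubit) : ℝ :=
  ∑ i, w i * (C (ρ i) * τ i).trace.re

/-- The set of values of the figure of merit over all quantum operations. -/
def achievable (w : Fin 2 → ℝ) (ρ τ : Fin 2 → Qubit) : Set ℝ :=
  avgFidelity w ρ τ '' cptp

/-- `C` is a quantum operation that is optimal for the tracking problem. -/
def IsOptimal (w : Fin 2 → ℝ) (ρ τ : Fin 2 → Qubit) (C : Qubit →CP Qubit) : Prop :=
  C ∈ cptp ∧ ∀ C' ∈ cptp, avgFidelity w ρ τ C' ≤ avgFidelity w ρ τ C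

/-- `C` is conjugation by a unitary. -/
def IsUnitaryOperation (C : Qubit →CP Qubit) : Prop :=
  ∃ U ∈ Matrix.unitaryGroup (Fin 2) ℂ, ∀ A : Qubit, C A = U * A * Uᴴ

/-! ### The indicator function

Below, `r i` is the Bloch vector of the `i`-th source state and `t i` is the Bloch vector of the
`i`-th target state multiplied by its priority. -/

/-- The length of the cross product of a pair of vectors. -/
noncomputable def crossLen (v : Fin 2 → E3) : ℝ :=
  ‖(WithLp.toLp 2 (crossProduct (v 0).ofLp (v 1).ofLp) : E3)‖

/-- The length of the difference of a pair of vectors. -/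
noncomputable def diffLen (v : Fin 2 → E3) : ℝ := ‖v 0 - v 1‖

/-- `T = ∑ᵢⱼ (1 - rᵢ·rⱼ) (tᵢ·tⱼ)`. -/
noncomputable def quantT (r t : Fin 2 → E3) : ℝ :=
  ∑ i, ∑ j, (1 - inner ℝ (r i) (r j)) * inner ℝ (t i) (t j)

/-- `S = √(T² + 4 |t₁×t₂|² (|r₁-r₂|² - |r₁×r₂|²))`. -/
noncomputable def quantS (r t : Fin 2 → E3) : ℝ :=
  √(quantT r t ^ 2 + 4 * crossLen t ^ 2 * (diffLen r ^ 2 - crossLen r ^ 2))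

/-- The indicator `Ω = S + T - 2 |t₁×t₂| |r₁×r₂|` in terms of Bloch vectors. -/
noncomputable def omegaVec (r t : Fin 2 → E3) : ℝ :=
  quantS r t + quantT r t - 2 * crossLen t * crossLen r

/-- Bloch vectors of the sources. -/
noncomputable def srcVec (ρ : Fin 2 → Qubit) : Fin 2 → E3 := fun i => bloch (ρ i)

/-- Bloch vectors of the targets weighted with the priorities. -/
noncomputable def tgtVec (w : Fin 2 → ℝ) (τ : Fin 2 → Qubit) : Fin 2 → E3 :=
  fun i => w i • bloch (τ i)

/-- The indicator function `Ω` of the tracking problem. -/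
noncomputable def Omega (w : Fin 2 → ℝ) (ρ τ : Fin 2 → Qubit) : ℝ :=
  omegaVec (srcVec ρ) (tgtVec w τ)

/-! ### Procedure A -/

/-- The contraction factor of the `x` component. -/
noncomputable def mu1 (r t : Fin 2 → E3) : ℝ :=
  2 * √(2 / (quantS r t * (quantS r t + quantT r t) ^ 3)) *
    crossLen t ^ 2 * crossLen r * diffLen r

/-- The contraction factor of the `y` component. -/
noncomputable def mu2 (r t : Fin 2 → E3) : ℝ :=
  2 / (quantS r t + quantT r t) * crossLen t * crossLen r

/-- The contraction factor of the `z` component. -/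
noncomputable def mu3 (r t : Fin 2 → E3) : ℝ :=
  √(2 / (quantS r t * (quantS r t + quantT r t))) * crossLen t * diffLen r

/-- The translation along the `x` direction. -/
noncomputable def s1 (r t : Fin 2 → E3) : ℝ :=
  √(1 / (2 * quantS r t * (quantS r t + quantT r t) ^ 3)) *
    ((quantS r t + quantT r t) ^ 2 - 4 * crossLen t ^ 2 * crossLen r ^ 2)

/-- The map that acts on Bloch vectors of unit trace operators by
`(x, y, z) ↦ (s + m₁ x, m₂ y, m₃ z)`, extended linearly to all operators. -/
noncomputable def affineMap (m₁ m₂ m₃ s : ℝ) (A : Qubit) : Qubit :=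
  (1 / 2 : ℂ) • (A.trace • (1 : Qubit)
    + ((s : ℂ) * A.trace + (m₁ : ℂ) * (pauliX * A).trace) • pauliX
    + ((m₂ : ℂ) * (pauliY * A).trace) • pauliY
    + ((m₃ : ℂ) * (pauliZ * A).trace) • pauliZ)

/-- `α = √((S+T)/(2S))`. -/
noncomputable def alphaA (r t : Fin 2 → E3) : ℝ :=
  √((quantS r t + quantT r t) / (2 * quantS r t))

/-- `βᵢ = √(2/(S(S+T))) rᵢ·(r₁-r₂)`. -/
noncomputable def betaA (r t : Fin 2 → E3) (i : Fin 2) : ℝ :=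
  √(2 / (quantS r t * (quantS r t + quantT r t))) * inner ℝ (r i) (r 0 - r 1)

/-- The normalization `Γ` of the final rotation. -/
noncomputable def gammaNorm (t : Fin 2 → E3) (α : ℝ) (β : Fin 2 → ℝ) : ℝ :=
  √(α ^ 2 * ‖t 0 + t 1‖ ^ 2
    + (‖β 0 • t 0 + β 1 • t 1‖ ^ 2 + 2 * α * (β 0 - β 1)) * crossLen t ^ 2)

/-- The coefficients `kᵢⱼ` of the final rotation; `i.rev` is the index other than `i`. -/
noncomputable def kCoeff (t : Fin 2 → E3) (α : ℝ) (β : Fin 2 → ℝ) (i j : Fin 2) : ℝ :=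
  1 / gammaNorm t α β *
    (α ^ 2 + β i * β j * crossLen t ^ 2
      + (-1 : ℝ) ^ ((i : ℕ) + (j : ℕ)) * α * (β 0 - β 1) * inner ℝ (t i.rev) (t j.rev))

/-- `C` implements procedure A, `C(A) = U D(V A V†) U†`:
the unitary `V` rotates the sources to the `xz`-plane with a common non-negative `x` component and
difference along `+z`; `D` contracts the Bloch ball by `μ₁, μ₂, μ₃` and translates it by `s₁` along
`x`; the unitary `U` rotates the result to the prescribed combinations of the targets. -/
def IsProcedureA (w : Fin 2 → ℝ) (ρ τ : Fin 2 → Qubit) (C : Qubit →CP Qubit) : Prop :=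
  let r := srcVec ρ
  let t := tgtVec w τ
  let D := affineMap (mu1 r t) (mu2 r t) (mu3 r t) (s1 r t)
  ∃ U ∈ Matrix.unitaryGroup (Fin 2) ℂ, ∃ V ∈ Matrix.unitaryGroup (Fin 2) ℂ,
    (∀ i, bloch (V * ρ i * Vᴴ)
      = !₂[crossLen r / diffLen r, 0, inner ℝ (r i) (r 0 - r 1) / diffLen r]) ∧
    (∀ i, bloch (U * D (V * ρ i * Vᴴ) * Uᴴ)
      = kCoeff t (alphaA r t) (betaA r t) i 0 • t 0
        + kCoeff t (alphaA r t) (betaA r t) i 1 • t 1) ∧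
    ∀ A : Qubit, C A = U * D (V * A * Vᴴ) * Uᴴ

/-! ### Stabilization against dephasing -/

/-- `|+⟩ = (|0⟩ + |1⟩)/√2`. -/
noncomputable def ketPlus : Fin 2 → ℂ := ![1 / (√2 : ℝ), 1 / (√2 : ℝ)]

/-- `|-⟩ = (|0⟩ - |1⟩)/√2`. -/
noncomputable def ketMinus : Fin 2 → ℂ := ![1 / (√2 : ℝ), -(1 / (√2 : ℝ))]

/-- The two preparations `cos(φ/2)|+⟩ ± sin(φ/2)|-⟩`, with half-angle `φ` on the Bloch sphere. -/
noncomputable def prepared (φ : ℝ) : Fin 2 → (Fin 2 → ℂ) :=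
  ![((Real.cos (φ / 2) : ℝ) : ℂ) • ketPlus + ((Real.sin (φ / 2) : ℝ) : ℂ) • ketMinus,
    ((Real.cos (φ / 2) : ℝ) : ℂ) • ketPlus - ((Real.sin (φ / 2) : ℝ) : ℂ) • ketMinus]

/-- The dephasing channel `A ↦ p Z A Z + (1-p) A`. -/
noncomputable def dephasing (p : ℝ) (A : Qubit) : Qubit :=
  (p : ℂ) • (pauliZ * A * pauliZ) + ((1 - p : ℝ) : ℂ) • A

/-- Equal priorities. -/
noncomputable def equalPriority : Fin 2 → ℝ := fun _ => 1 / 2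

end QubitTracking

open QubitTracking

/-!
The average fidelity depends on the sources and on the targets only up to a rotation of each pair,
so both pairs may be put into a plane: the sources at the Bloch vectors `(a, 0, ±b)` and the targets
at `(c, 0, ±s)` with `c² + s² = 1` (`exists_isFrame`). With `a = R cos θ` and `b = R sin θ` this is
the first family of problems; dephasing gives `a = (1 - 2p) c` and `b = s`. In this normal form
`Ω = 2 (c² (1 - a²) - a b c s)`.

Upper bound. A quantum operation has Kraus operators (`exists_kraus`), and the average fidelity is
the sum of a quadratic form `f` over them. If a Hermitian operator `Q` satisfies
`f(K) ≤ Tr[Q K†K]` for all `K`, then the completeness relation bounds the fidelity by `Tr Q`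
(`DualFeasible.avgFidelity_le`). Since the problem in normal form is symmetric under `X ⊗ X`, this
condition splits into two `2 × 2` blocks. The choice `Q = (1 + P) (1 + a X) / 4` with
`P² = c² + b² s² / (1 - a²)`, that is, `l = P` and `m = P a` in `DualFeasible`, makes both blocks
singular and is always feasible, so that `F ≤ (1 + P) / 2` (`dualFeasible_sqrt`). The choice
`l = a c + b s`, `m = c` is feasible exactly when `Ω ≤ 0` (`dualFeasible_unitary`).

Attainment. The bound `(1 + a c + b s) / 2` is the fidelity of the rotation that aligns the two
planes. In normal form procedure A maps `(a, 0, ±b)` to `(c / P, 0, ±b² s / (P (1 - a²)))`, which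
has the fidelity `(1 + P) / 2`. This value can be read off the prescribed outputs
(`PlanarProblem.avgFidelity_of_isProcedureA`), so every operation that implements the procedure is
optimal. The contraction it uses satisfies `μ₁ = μ₂ μ₃` and `s₁² = (1 - μ₂²) (1 - μ₃²)`; a positive
`Ω` means `μ₂ < 1`, and then the contraction has two Kraus operators (`exists_kraus_affineMap`).
-/

namespace QubitTracking

/-! ### Kraus representations -/

lemma exists_eq_star_mul_self_of_nonneg {A : Type*} [NonUnitalCStarAlgebra A] [PartialOrder A]
    [StarOrderedRing A] {M : A} (hM : 0 ≤ M) : ∃ B, M = star B * B :=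
  CStarAlgebra.nonneg_iff_eq_star_mul_self.mp hM

/-- The matrix over `Qubit` with the given entries. -/
def blockMatrix {m n : Type*} (f : m → n → Qubit) : CStarMatrix m n Qubit :=
  CStarMatrix.ofMatrix (Matrix.of f)

lemma blockMatrix_apply {m n : Type*} (f : m → n → Qubit) (i : m) (j : n) :
    blockMatrix f i j = f i j := rfl

/-- The completely positive map `A ↦ ∑ᵢ Kᵢ A Kᵢ†` with Kraus operators `K`. -/
noncomputable def krausMap {ι : Type*} [Fintype ι] (K : ι → Qubit) : Qubit →CP Qubit where
  toFun A := ∑ i, K i * A * (K i)ᴴ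
  map_add' A B := by simp [mul_add, add_mul, Finset.sum_add_distrib]
  map_smul' c A := by simp [Finset.smul_sum]
  map_cstarMatrix_nonneg' k M hM := by
    -- Conjugating every entry of `B†B` with `L` gives `B'†B'`, where `B'` has the entries `Bᵢⱼ L†`.
    obtain ⟨B, rfl⟩ := exists_eq_star_mul_self_of_nonneg hM
    have key : ∀ L : Qubit, (0 : CStarMatrix (Fin k) (Fin k) Qubit) ≤
        blockMatrix (fun i j => L * (star B * B) i j * Lᴴ) := by
      intro L
      have h : blockMatrix (fun i j => L * (star B * B) i j * Lᴴ)
          = star (blockMatrix (fun i j => B i j * Lᴴ))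
            * blockMatrix (fun i j => B i j * Lᴴ) := by
        ext1 i j
        simp only [blockMatrix_apply, CStarMatrix.mul_apply, CStarMatrix.star_apply,
          Finset.mul_sum, Finset.sum_mul, Matrix.star_eq_conjTranspose, Matrix.conjTranspose_mul,
          Matrix.conjTranspose_conjTranspose, mul_assoc]
      rw [h]
      exact star_mul_self_nonneg _
    have hs : (star B * B).map (fun A => ∑ i, K i * A * (K i)ᴴ)
        = ∑ l, blockMatrix (fun i j => K l * (star B * B) i j * (K l)ᴴ) := by
      ext1 i j
      have hsum : ∀ (t : Finset ι) (f : ι → CStarMatrix (Fin k) (Fin k) Qubit),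
          (∑ l ∈ t, f l) i j = ∑ l ∈ t, f l i j := by
        intro t f
        classical
        induction t using Finset.induction_on with
        | empty => rfl
        | insert x t hx ih => rw [Finset.sum_insert hx, Finset.sum_insert hx,
            CStarMatrix.add_apply, ih]
      rw [hsum]
      rfl
    exact hs ▸ Finset.sum_nonneg fun l _ => key (K l)

lemma krausMap_apply {ι : Type*} [Fintype ι] (K : ι → Qubit) (A : Qubit) :
    krausMap K A = ∑ i, K i * A * (K i)ᴴ := rfl

/-- Every completely positive map has a Kraus representation: the Choi matrix `[C(Eᵢⱼ)]` is
positive, hence of the form `B†B`, and the entries of `B` are those of the Kraus operators. -/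
theorem exists_kraus (C : Qubit →CP Qubit) :
    ∃ K : Fin 2 × Fin 2 → Qubit, ∀ A, C A = ∑ l, K l * A * (K l)ᴴ := by
  -- `N` is the unnormalized maximally entangled state, whose image under `C` is the Choi matrix.
  let N : CStarMatrix (Fin 2) (Fin 2) Qubit :=
    blockMatrix fun i j => Matrix.single i j 1
  have hN : 0 ≤ N := by
    have h : N = star (blockMatrix fun i j => if i = 0 then Matrix.single 0 j 1 else 0)
        * (blockMatrix fun i j => if i = 0 then (Matrix.single 0 j 1 : Qubit) else 0) := by
      ext1 i j
      simp [N, blockMatrix_apply, CStarMatrix.mul_apply, CStarMatrix.star_apply,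
        Matrix.star_eq_conjTranspose]
    rw [h]
    exact star_mul_self_nonneg _
  obtain ⟨B, hB⟩ := exists_eq_star_mul_self_of_nonneg (C.map_cstarMatrix_nonneg N hN)
  have hC : ∀ i j, C (Matrix.single i j 1) = ∑ k, (B k i)ᴴ * B k j := by
    intro i j
    have := congrArg (fun M : CStarMatrix (Fin 2) (Fin 2) Qubit => M i j) hB
    simpa [N, blockMatrix_apply, CStarMatrix.mul_apply, CStarMatrix.star_apply,
        Matrix.star_eq_conjTranspose]
      using this
  refine ⟨fun l => Matrix.of fun x i => star (B l.1 i l.2 x), fun A => ?_⟩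
  have hA : C A = ∑ i, ∑ j, A i j • C (Matrix.single i j 1) := by
    conv_lhs => rw [Matrix.matrix_eq_sum_single A]
    simp only [map_sum]
    refine Finset.sum_congr rfl fun i _ => Finset.sum_congr rfl fun j _ => ?_
    rw [← map_smul, Matrix.smul_single, smul_eq_mul, mul_one]
  rw [hA]
  simp only [hC]
  ext x y
  simp [Fintype.sum_prod_type, Matrix.sum_apply, Matrix.mul_apply, Fin.sum_univ_two]
  ring

/-- A Kraus representation of a trace preserving map satisfies the completeness relation. -/
lemma sum_conjTranspose_mul_self_eq_one {ι : Type*} [Fintype ι] {K : ι → Qubit}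
    {C : Qubit →CP Qubit} (hC : C ∈ cptp) (hK : ∀ A, C A = ∑ l, K l * A * (K l)ᴴ) :
    ∑ l, (K l)ᴴ * K l = 1 := by
  apply Matrix.ext_iff_trace_mul_right.mpr
  intro A
  rw [one_mul, ← hC A, hK A, Finset.sum_mul, Matrix.trace_sum, Matrix.trace_sum]
  refine Finset.sum_congr rfl fun l _ => ?_
  rw [mul_assoc, Matrix.trace_mul_comm]

lemma krausMap_mem_cptp {ι : Type*} [Fintype ι] {K : ι → Qubit}
    (hK : ∑ l, (K l)ᴴ * K l = 1) : krausMap K ∈ cptp := by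
  intro A
  have h : (krausMap K A).trace = ((∑ l, (K l)ᴴ * K l) * A).trace := by
    rw [krausMap_apply, Finset.sum_mul, Matrix.trace_sum, Matrix.trace_sum]
    refine Finset.sum_congr rfl fun l _ => ?_
    rw [mul_assoc (K l)ᴴ, Matrix.trace_mul_comm]
  rw [h, hK, one_mul]

/-! ### Bloch vectors -/

lemma bloch_apply_zero (A : Qubit) : bloch A 0 = (A 0 1).re + (A 1 0).re := by
  simp [bloch, pauliX, -Matrix.cons_mul, Matrix.trace_fin_two, Matrix.mul_apply,
    Fin.sum_univ_two, add_comm]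

lemma bloch_apply_one (A : Qubit) : bloch A 1 = (A 1 0).im - (A 0 1).im := by
  simp [bloch, pauliY, -Matrix.cons_mul, Matrix.trace_fin_two, Matrix.mul_apply,
    Fin.sum_univ_two, sub_eq_add_neg]

lemma bloch_apply_two (A : Qubit) : bloch A 2 = (A 0 0).re - (A 1 1).re := by
  simp [bloch, pauliZ, -Matrix.cons_mul, Matrix.trace_fin_two, Matrix.mul_apply,
    Fin.sum_univ_two, sub_eq_add_neg]

lemma conj_apply (K A : Qubit) (i j : Fin 2) :
    (K * A * Kᴴ) i j = (K i 0 * A 0 0 + K i 1 * A 1 0) * star (K j 0)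
      + (K i 0 * A 0 1 + K i 1 * A 1 1) * star (K j 1) := by
  simp only [Matrix.mul_apply, Fin.sum_univ_two, Matrix.conjTranspose_apply]

lemma E3.ext {u v : E3} (h0 : u 0 = v 0) (h1 : u 1 = v 1) (h2 : u 2 = v 2) : u = v := by
  ext i
  fin_cases i
  exacts [h0, h1, h2]

lemma inner_eq (u v : E3) : inner ℝ u v = u 0 * v 0 + u 1 * v 1 + u 2 * v 2 := by
  simp [PiLp.inner_apply, Fin.sum_univ_three, mul_comm]

lemma norm_sq_eq (u : E3) : ‖u‖ ^ 2 = u 0 ^ 2 + u 1 ^ 2 + u 2 ^ 2 := by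
  rw [← real_inner_self_eq_norm_sq, inner_eq]
  ring

lemma bloch_add (A B : Qubit) : bloch (A + B) = bloch A + bloch B := by
  apply E3.ext <;>
    simp [bloch_apply_zero, bloch_apply_one, bloch_apply_two] <;> ring

lemma bloch_ofReal_smul (x : ℝ) (A : Qubit) : bloch ((x : ℂ) • A) = x • bloch A := by
  apply E3.ext <;>
    simp [bloch_apply_zero, bloch_apply_one, bloch_apply_two] <;> ring

lemma bloch_one : bloch 1 = 0 := by
  apply E3.ext <;> simp [bloch_apply_zero, bloch_apply_one, bloch_apply_two]

/-- The Hermitian operator of unit trace with Bloch vector `(x, 0, z)`. -/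
noncomputable def planar (x z : ℝ) : Qubit :=
  !![(1 + z) / 2, x / 2; x / 2, (1 - z) / 2]

lemma bloch_planar (x z : ℝ) : bloch (planar x z) = !₂[x, 0, z] := by
  apply E3.ext <;>
    simp [bloch_apply_zero, bloch_apply_one, bloch_apply_two, planar]
  ring

lemma trace_planar (x z : ℝ) : (planar x z).trace = 1 := by
  simp [planar, Matrix.trace_fin_two]
  ring

/-- A Hermitian operator of unit trace is determined by its Bloch vector. -/
lemma eq_of_bloch_eq {A B : Qubit} (hA : A.IsHermitian) (hB : B.IsHermitian)
    (h : A.trace = B.trace) (hv : bloch A = bloch B) : A = B := by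
  have ha := fun i j => congrArg (fun M : Qubit => M i j) hA
  have hb := fun i j => congrArg (fun M : Qubit => M i j) hB
  have h0 := congrArg (fun v : E3 => v 0) hv
  have h1 := congrArg (fun v : E3 => v 1) hv
  have h2 := congrArg (fun v : E3 => v 2) hv
  simp only [bloch_apply_zero, bloch_apply_one, bloch_apply_two] at h0 h1 h2
  simp only [Matrix.trace_fin_two] at h
  have a00 := congrArg Complex.im (ha 0 0)
  have a11 := congrArg Complex.im (ha 1 1)
  have a01 := ha 0 1
  have b00 := congrArg Complex.im (hb 0 0)
  have b11 := congrArg Complex.im (hb 1 1)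
  have b01 := hb 0 1
  have hr := congrArg Complex.re h
  simp [Complex.ext_iff] at a00 a11 a01 b00 b11 b01 hr
  ext i j
  fin_cases i <;> fin_cases j <;> apply Complex.ext <;> simp <;> linarith

lemma isHermitian_planar (x z : ℝ) : (planar x z).IsHermitian := by
  ext i j
  fin_cases i <;> fin_cases j <;> simp [planar]

/-- For Hermitian operators of unit trace, `Tr[AB] = (1 + a·b)/2`. -/
lemma trace_mul_re_eq {A B : Qubit} (hA : A.IsHermitian) (hB : B.IsHermitian)
    (hA1 : A.trace = 1) (hB1 : B.trace = 1) :
    (A * B).trace.re = (1 + inner ℝ (bloch A) (bloch B)) / 2 := by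
  have ha := fun i j => congrArg (fun M : Qubit => M i j) hA
  have hb := fun i j => congrArg (fun M : Qubit => M i j) hB
  have a00 := congrArg Complex.im (ha 0 0)
  have a11 := congrArg Complex.im (ha 1 1)
  have a01 := ha 0 1
  have b00 := congrArg Complex.im (hb 0 0)
  have b11 := congrArg Complex.im (hb 1 1)
  have b01 := hb 0 1
  rw [Matrix.trace_fin_two] at hA1 hB1
  have hra := congrArg Complex.re hA1
  have hrb := congrArg Complex.re hB1
  simp [Complex.ext_iff] at a00 a11 a01 b00 b11 b01 hra hrb
  rw [inner_eq]
  simp only [bloch_apply_zero, bloch_apply_one, bloch_apply_two, Matrix.trace_fin_two,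
    Matrix.mul_apply, Fin.sum_univ_two, Complex.add_re, Complex.mul_re]
  obtain ⟨h1, h2⟩ := a01
  obtain ⟨h3, h4⟩ := b01
  rw [← h1, ← h3, ← h2, ← h4]
  have e1 : (A 0 0).im = 0 := by linarith
  have e2 : (A 1 1).im = 0 := by linarith
  rw [e1, e2, show (A 0 0).re = 1 - (A 1 1).re by linarith,
    show (B 0 0).re = 1 - (B 1 1).re by linarith]
  ring

/-! ### Unitaries that rotate the Bloch ball -/

/-- `f` is the rotation of Bloch vectors induced by conjugation with a unitary. -/
def IsBlochRotation (f : E3 → E3) : Prop :=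
  ∃ U ∈ Matrix.unitaryGroup (Fin 2) ℂ, ∀ A, bloch (U * A * Uᴴ) = f (bloch A)

lemma IsBlochRotation.comp {f g : E3 → E3} (hf : IsBlochRotation f) (hg : IsBlochRotation g) :
    IsBlochRotation fun v => f (g v) := by
  obtain ⟨U, hU, hUf⟩ := hf
  obtain ⟨V, hV, hVg⟩ := hg
  refine ⟨U * V, mul_mem hU hV, fun A => ?_⟩
  simp only [← hVg, ← hUf, Matrix.conjTranspose_mul, mul_assoc]

/-- The rotation about the `z` axis by the angle `φ`. -/
noncomputable def rotZ (φ : ℝ) (v : E3) : E3 :=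
  !₂[Real.cos φ * v 0 - Real.sin φ * v 1, Real.sin φ * v 0 + Real.cos φ * v 1, v 2]

/-- The rotation about the `y` axis by the angle `φ`. -/
noncomputable def rotY (φ : ℝ) (v : E3) : E3 :=
  !₂[Real.cos φ * v 0 + Real.sin φ * v 2, v 1, Real.cos φ * v 2 - Real.sin φ * v 0]

lemma isBlochRotation_rotZ (φ : ℝ) : IsBlochRotation (rotZ φ) := by
  have hφ := Real.sin_sq_add_cos_sq φ
  refine ⟨!![1, 0; 0, ⟨Real.cos φ, Real.sin φ⟩], ?_, fun A => ?_⟩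
  · rw [Matrix.mem_unitaryGroup_iff]
    ext i j
    fin_cases i <;> fin_cases j <;>
      simp [Matrix.mul_apply, Fin.sum_univ_two, Complex.ext_iff, Matrix.star_apply]
    constructor <;> nlinarith
  · apply E3.ext <;>
      simp only [bloch_apply_zero, bloch_apply_one, bloch_apply_two, conj_apply] <;>
      simp [bloch_apply_zero, bloch_apply_one, bloch_apply_two, rotZ] <;> ring_nf
    linear_combination (A 1 1).re * hφ

lemma isBlochRotation_rotY (φ : ℝ) : IsBlochRotation (rotY φ) := by
  have hc : Real.cos φ = Real.cos (φ / 2) ^ 2 - Real.sin (φ / 2) ^ 2 := by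
    rw [← Real.cos_two_mul']; ring_nf
  have hs : Real.sin φ = 2 * Real.sin (φ / 2) * Real.cos (φ / 2) := by
    rw [← Real.sin_two_mul]; ring_nf
  have hr := Real.sin_sq_add_cos_sq (φ / 2)
  refine ⟨!![(Real.cos (φ / 2) : ℂ), (-Real.sin (φ / 2) : ℂ);
    (Real.sin (φ / 2) : ℂ), (Real.cos (φ / 2) : ℂ)], ?_, fun A => ?_⟩
  · rw [Matrix.mem_unitaryGroup_iff]
    ext i j
    fin_cases i <;> fin_cases j <;>
      simp only [Matrix.mul_apply, Fin.sum_univ_two, Matrix.star_apply] <;>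
      simp [-Complex.ofReal_div, Complex.conj_ofReal, -Complex.ofReal_cos, -Complex.ofReal_sin] <;>
      norm_cast <;> nlinarith
  · apply E3.ext <;>
      simp only [bloch_apply_zero, bloch_apply_one, bloch_apply_two, conj_apply] <;>
      simp [bloch_apply_zero, bloch_apply_one, bloch_apply_two, rotY,
        -Complex.ofReal_cos, -Complex.ofReal_sin, hc, hs, -Complex.ofReal_div]
    · ring
    · linear_combination ((A 1 0).im - (A 0 1).im) * hr
    · ring

lemma inner_rotZ (φ : ℝ) (u v : E3) : inner ℝ (rotZ φ u) (rotZ φ v) = inner ℝ u v := by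
  rw [inner_eq, inner_eq]
  simp [rotZ]
  linear_combination (u 0 * v 0 + u 1 * v 1) * Real.sin_sq_add_cos_sq φ

lemma inner_rotY (φ : ℝ) (u v : E3) : inner ℝ (rotY φ u) (rotY φ v) = inner ℝ u v := by
  rw [inner_eq, inner_eq]
  simp [rotY]
  linear_combination (u 0 * v 0 + u 2 * v 2) * Real.sin_sq_add_cos_sq φ

lemma exists_polar (x y : ℝ) : ∃ r φ : ℝ, 0 ≤ r ∧ x = r * Real.cos φ ∧ y = r * Real.sin φ :=
  ⟨‖(⟨x, y⟩ : ℂ)‖, Complex.arg ⟨x, y⟩, norm_nonneg _,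
    (Complex.norm_mul_cos_arg ⟨x, y⟩).symm,
    (Complex.norm_mul_sin_arg ⟨x, y⟩).symm⟩

lemma eq_norm_of_inner_self {r : ℝ} (hr : 0 ≤ r) {v : E3} (h : r ^ 2 = inner ℝ v v) : r = ‖v‖ := by
  rw [real_inner_self_eq_norm_sq] at h
  exact (sq_eq_sq₀ hr (norm_nonneg _)).mp h

/-- Every vector can be rotated to the positive `z` axis. -/
lemma exists_rotation_to_z (v : E3) : ∃ f : E3 → E3, IsBlochRotation f ∧
    (∀ x y, inner ℝ (f x) (f y) = inner ℝ x y) ∧ f v = !₂[0, 0, ‖v‖] := by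
  obtain ⟨r, φ, -, hx, hy⟩ := exists_polar (v 0) (v 1)
  obtain ⟨n, χ, hn, hz, hr⟩ := exists_polar (v 2) r
  have hφ := Real.sin_sq_add_cos_sq φ
  have hχ := Real.sin_sq_add_cos_sq χ
  have hf : ∀ x y, inner ℝ (rotY (-χ) (rotZ (-φ) x)) (rotY (-χ) (rotZ (-φ) y))
      = inner ℝ x y := fun x y => by rw [inner_rotY, inner_rotZ]
  have h : rotY (-χ) (rotZ (-φ) v) = !₂[0, 0, n] := by
    apply E3.ext <;> simp [rotY, rotZ, hx, hy, hz]
    · linear_combination r * Real.cos χ * hφ + Real.cos χ * hr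
    · ring
    · linear_combination r * Real.sin χ * hφ + n * hχ + Real.sin χ * hr
  refine ⟨_, (isBlochRotation_rotY (-χ)).comp (isBlochRotation_rotZ (-φ)), hf, ?_⟩
  have hn' : n = ‖v‖ := eq_norm_of_inner_self hn (by rw [← hf v v, h, inner_eq]; simp; ring)
  rw [h, hn']

/-- Two orthogonal vectors can be rotated to the positive `x` and `z` axes. -/
lemma exists_rotation_to_xz {u v : E3} (huv : inner ℝ u v = 0) :
    ∃ f : E3 → E3, IsBlochRotation f ∧ f u = !₂[‖u‖, 0, 0] ∧ f v = !₂[0, 0, ‖v‖] := by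
  -- For `v = 0` orthogonality carries no information, and `u` is rotated by way of the `z` axis.
  rcases eq_or_ne v 0 with rfl | hv
  · obtain ⟨f, hf, hfi, hfu⟩ := exists_rotation_to_z u
    have hf0 : f 0 = 0 := by
      have := hfi 0 0
      rwa [inner_zero_left, inner_self_eq_zero] at this
    refine ⟨_, (isBlochRotation_rotY (Real.pi / 2)).comp hf, ?_, ?_⟩
    · apply E3.ext <;> simp [hfu, rotY]
    · apply E3.ext <;> simp [hf0, rotY]
  · obtain ⟨f, hf, hfi, hfv⟩ := exists_rotation_to_z v
    have h2 : f u 2 = 0 := by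
      have := hfi u v
      rw [huv, hfv, inner_eq] at this
      simpa [hv] using this
    obtain ⟨r, φ, hr, hx, hy⟩ := exists_polar (f u 0) (f u 1)
    have hφ := Real.sin_sq_add_cos_sq φ
    have hfu : rotZ (-φ) (f u) = !₂[r, 0, 0] := by
      apply E3.ext <;> simp [rotZ, hx, hy, h2]
      · linear_combination r * hφ
      · ring
    have hr' : r = ‖u‖ := by
      refine eq_norm_of_inner_self hr ?_
      rw [← hfi, ← inner_rotZ (-φ), hfu, inner_eq]
      simp
      ring
    refine ⟨_, (isBlochRotation_rotZ (-φ)).comp hf, ?_, ?_⟩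
    · rw [hfu, hr']
    · apply E3.ext <;> simp [hfv, rotZ]

/-! ### The dual bound on the average fidelity -/

lemma two_mul_inner_le {A B C x₁ x₂ y₁ y₂ : ℝ} (hA : 0 ≤ A) (hB : 0 ≤ B) (h : C ^ 2 ≤ A * B) :
    2 * C * (x₁ * y₁ + x₂ * y₂) ≤ A * (x₁ ^ 2 + x₂ ^ 2) + B * (y₁ ^ 2 + y₂ ^ 2) := by
  rcases hA.eq_or_lt with rfl | hA
  · have hC : C = 0 := by nlinarith
    subst hC
    simp only [mul_zero, zero_mul, zero_add]
    positivity
  · have h1 : 0 ≤ (A * x₁ - C * y₁) ^ 2 + (A * x₂ - C * y₂) ^ 2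
        + (A * B - C ^ 2) * (y₁ ^ 2 + y₂ ^ 2) := by
      have := sub_nonneg.mpr h
      positivity
    refine le_of_mul_le_mul_left (a := A) ?_ hA
    linarith

/-- Numbers `l`, `m` are dual feasible for the planar configuration with sources `(a, 0, ±b)` and
targets `(c, 0, ±s)` if the operator `Q ⊗ 1 - M` is positive semidefinite, where
`Q = ((1 + l) + (a + m) X) / 4` and `M` is the operator representing the average fidelity. In the
eigenbasis of `X` this operator consists of two `2 × 2` blocks, whose positivity is spelled out
here. -/
structure DualFeasible (a b c s l m : ℝ) : Prop where
  nonneg₁ : 0 ≤ l + m - c - c * a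
  nonneg₂ : 0 ≤ l - m + c - c * a
  nonneg₃ : 0 ≤ l - m - c + c * a
  nonneg₄ : 0 ≤ l + m + c + c * a
  det₁₂ : (s * b) ^ 2 ≤ (l + m - c - c * a) * (l - m + c - c * a)
  det₃₄ : (s * b) ^ 2 ≤ (l - m - c + c * a) * (l + m + c + c * a)

/-- The contribution of one Kraus operator to the average fidelity. -/
lemma DualFeasible.kraus_bound {a b c s l m : ℝ} (h : DualFeasible a b c s l m) (K : Qubit) :
    1 / 2 * (K * planar a b * Kᴴ * planar c s).trace.re
      + 1 / 2 * (K * planar a (-b) * Kᴴ * planar c (-s)).trace.re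
    ≤ ((!![((1 + l : ℝ) : ℂ) / 4, ((a + m : ℝ) : ℂ) / 4;
          ((a + m : ℝ) : ℂ) / 4, ((1 + l : ℝ) : ℂ) / 4] : Qubit) * (Kᴴ * K)).trace.re := by
  -- The blocks act on the entries of `K` in the eigenbasis of `X`.
  have h12 := two_mul_inner_le (x₁ := (K 0 0).re + (K 0 1).re + (K 1 0).re + (K 1 1).re)
    (x₂ := (K 0 0).im + (K 0 1).im + (K 1 0).im + (K 1 1).im)
    (y₁ := (K 0 0).re - (K 0 1).re - (K 1 0).re + (K 1 1).re)
    (y₂ := (K 0 0).im - (K 0 1).im - (K 1 0).im + (K 1 1).im) h.nonneg₁ h.nonneg₂ h.det₁₂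
  have h34 := two_mul_inner_le (x₁ := (K 0 0).re - (K 0 1).re + (K 1 0).re - (K 1 1).re)
    (x₂ := (K 0 0).im - (K 0 1).im + (K 1 0).im - (K 1 1).im)
    (y₁ := (K 0 0).re + (K 0 1).re - (K 1 0).re - (K 1 1).re)
    (y₂ := (K 0 0).im + (K 0 1).im - (K 1 0).im - (K 1 1).im) h.nonneg₃ h.nonneg₄ h.det₃₄
  have hr : ∀ x y : ℝ, planar x y
      = !![(((1 + y) / 2 : ℝ) : ℂ), ((x / 2 : ℝ) : ℂ); ((x / 2 : ℝ) : ℂ),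
        (((1 - y) / 2 : ℝ) : ℂ)] := by
    intro x y
    simp [planar]
  have hq : ∀ x : ℝ, ((x : ℂ) / 4) = ((x / 4 : ℝ) : ℂ) := by
    intro x
    simp
  rw [hr, hr, hr, hr, hq, hq]
  simp only [Matrix.trace_fin_two, Matrix.mul_apply, Fin.sum_univ_two,
    Matrix.conjTranspose_apply, Matrix.of_apply, Matrix.cons_val', Matrix.cons_val_zero,
    Matrix.cons_val_one, Matrix.cons_val_fin_one, Complex.add_re, Complex.mul_re, Complex.add_im,
    Complex.mul_im, Complex.ofReal_re, Complex.ofReal_im, RCLike.star_def, Complex.conj_re,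
    Complex.conj_im]
  linear_combination (h12 + h34) / 16

lemma avgFidelity_equalPriority (ρ τ : Fin 2 → Qubit) (C : Qubit →CP Qubit) :
    avgFidelity equalPriority ρ τ C
      = 1 / 2 * (C (ρ 0) * τ 0).trace.re + 1 / 2 * (C (ρ 1) * τ 1).trace.re := by
  simp [avgFidelity, equalPriority, Fin.sum_univ_two]

/-- Sign convention for a planar configuration: the states `0` and `1` have the `z` components
`+z` and `-z`. -/
def sgn : Fin 2 → ℝ := ![1, -1]

/-- `V` rotates the pair of states `ρ` to the Bloch vectors `(x, 0, ±z)`. -/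
structure IsFrame (V : Qubit) (ρ : Fin 2 → Qubit) (x z : ℝ) : Prop where
  mem : V ∈ Matrix.unitaryGroup (Fin 2) ℂ
  conj_eq : ∀ i, V * ρ i * Vᴴ = planar x (sgn i * z)

lemma IsFrame.conjTranspose_mul_self {V : Qubit} {ρ : Fin 2 → Qubit} {x z : ℝ}
    (h : IsFrame V ρ x z) : Vᴴ * V = 1 := Matrix.mem_unitaryGroup_iff'.mp h.mem

lemma IsFrame.mul_conjTranspose_self {V : Qubit} {ρ : Fin 2 → Qubit} {x z : ℝ}
    (h : IsFrame V ρ x z) : V * Vᴴ = 1 := Matrix.mem_unitaryGroup_iff.mp h.mem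

lemma IsFrame.eq {V : Qubit} {ρ : Fin 2 → Qubit} {x z : ℝ}
    (h : IsFrame V ρ x z) (i : Fin 2) : ρ i = Vᴴ * planar x (sgn i * z) * V := by
  have h1 := h.conjTranspose_mul_self
  rw [← h.conj_eq i]
  calc ρ i = (Vᴴ * V) * ρ i * (Vᴴ * V) := by rw [h1, one_mul, mul_one]
    _ = _ := by simp only [mul_assoc]

/-- Weak duality: a dual feasible point bounds the average fidelity of all quantum operations. -/
theorem DualFeasible.avgFidelity_le {a b c s l m : ℝ} (h : DualFeasible a b c s l m)
    {V W : Qubit} {ρ τ : Fin 2 → Qubit} (hV : IsFrame V ρ a b) (hW : IsFrame W τ c s)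
    {C : Qubit →CP Qubit} (hC : C ∈ cptp) :
    avgFidelity equalPriority ρ τ C ≤ 1 / 2 + 1 / 2 * l := by
  obtain ⟨K, hK⟩ := exists_kraus C
  have hK1 := sum_conjTranspose_mul_self_eq_one hC hK
  have htr : ∀ i, (C (ρ i) * τ i).trace.re = ∑ k, ((W * K k * Vᴴ) * planar a (sgn i * b)
      * (W * K k * Vᴴ)ᴴ * planar c (sgn i * s)).trace.re := by
    intro i
    rw [hK, Finset.sum_mul, Matrix.trace_sum, Complex.re_sum]
    refine Finset.sum_congr rfl fun k _ => ?_
    rw [hV.eq i, hW.eq i]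
    simp only [Matrix.conjTranspose_mul, Matrix.conjTranspose_conjTranspose, ← mul_assoc]
    rw [Matrix.trace_mul_comm]
    simp only [mul_assoc]
  have hsum : ∑ k, (W * K k * Vᴴ)ᴴ * (W * K k * Vᴴ) = 1 := by
    have : ∀ k, (W * K k * Vᴴ)ᴴ * (W * K k * Vᴴ) = V * ((K k)ᴴ * K k) * Vᴴ := by
      intro k
      simp only [Matrix.conjTranspose_mul, Matrix.conjTranspose_conjTranspose]
      calc V * ((K k)ᴴ * Wᴴ) * (W * K k * Vᴴ) = V * ((K k)ᴴ * (Wᴴ * W) * K k) * Vᴴ := by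
            simp only [mul_assoc]
        _ = _ := by rw [hW.conjTranspose_mul_self, mul_one]
    simp only [this]
    rw [← Finset.sum_mul, ← Finset.mul_sum, hK1, mul_one, hV.mul_conjTranspose_self]
  rw [avgFidelity_equalPriority, htr, htr, Finset.mul_sum, Finset.mul_sum,
    ← Finset.sum_add_distrib]
  have hle := Finset.sum_le_sum fun k (_ : k ∈ Finset.univ) => h.kraus_bound (W * K k * Vᴴ)
  rw [← Complex.re_sum, ← Matrix.trace_sum, ← Finset.mul_sum, hsum, mul_one] at hle
  simp only [sgn, Matrix.cons_val_zero, Matrix.cons_val_one, Matrix.cons_val_fin_one, one_mul,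
    neg_mul]
  refine hle.trans (le_of_eq ?_)
  simp [Matrix.trace_fin_two]
  ring

/-- A dual feasible point that is sharp when the map of procedure A exists. -/
lemma dualFeasible_sqrt {a b c s : ℝ} (ha : 0 ≤ a) (ha1 : a < 1) (hc : 0 ≤ c) :
    DualFeasible a b c s √(c ^ 2 + b ^ 2 * s ^ 2 / (1 - a ^ 2))
      (√(c ^ 2 + b ^ 2 * s ^ 2 / (1 - a ^ 2)) * a) := by
  have hE : 0 < 1 - a ^ 2 := by nlinarith
  have hP := Real.sq_sqrt (show 0 ≤ c ^ 2 + b ^ 2 * s ^ 2 / (1 - a ^ 2) by positivity)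
  have hPc : c ≤ √(c ^ 2 + b ^ 2 * s ^ 2 / (1 - a ^ 2)) :=
    Real.le_sqrt_of_sq_le (le_add_of_nonneg_right (by positivity))
  set P := √(c ^ 2 + b ^ 2 * s ^ 2 / (1 - a ^ 2))
  have hPE : (s * b) ^ 2 = (P ^ 2 - c ^ 2) * (1 - a ^ 2) := by
    rw [hP]
    field_simp
    ring
  have e1 : P + P * a - c - c * a = (P - c) * (1 + a) := by ring
  have e2 : P - P * a + c - c * a = (P + c) * (1 - a) := by ring
  have e3 : P - P * a - c + c * a = (P - c) * (1 - a) := by ring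
  have e4 : P + P * a + c + c * a = (P + c) * (1 + a) := by ring
  have h1 : 0 ≤ P - c := by linarith
  have h2 : 0 ≤ P + c := by linarith
  have h3 : 0 ≤ 1 - a := by linarith
  refine ⟨?_, ?_, ?_, ?_, ?_, ?_⟩
  · rw [e1]; positivity
  · rw [e2]; positivity
  · rw [e3]; positivity
  · rw [e4]; positivity
  · rw [hPE]; exact le_of_eq (by ring)
  · rw [hPE]; exact le_of_eq (by ring)

/-- A dual feasible point that is sharp for a unitary operation; it requires the indicator function
to be non-positive. -/
lemma dualFeasible_unitary {a b c s : ℝ} (ha : 0 ≤ a) (hb : 0 < b) (ha1 : a < 1) (hc : 0 ≤ c)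
    (hs : 0 ≤ s) (hΩ : c ^ 2 * (1 - a ^ 2) ≤ a * b * c * s) :
    DualFeasible a b c s (a * c + b * s) c := by
  have hbs : 0 ≤ b * s := by positivity
  have h3 : 0 ≤ b * s - 2 * c * (1 - a) := by
    rcases hc.eq_or_lt with rfl | hc
    · simpa using hbs
    · have h : c * (1 - a) * (1 + a) ≤ a * (b * s) := by
        refine le_of_mul_le_mul_left (a := c) ?_ hc
        linarith
      have ha0 : 0 < a := by
        rcases ha.eq_or_lt with rfl | ha
        · linarith
        · exact ha
      refine nonneg_of_mul_nonneg_right (a := a) ?_ ha0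
      have h' : 0 ≤ c * (1 - a) ^ 2 := by positivity
      linarith
  refine ⟨?_, ?_, ?_, ?_, ?_, ?_⟩
  · linarith
  · linarith
  · linarith
  · nlinarith [mul_nonneg ha hc]
  · exact le_of_eq (by ring)
  · linarith

/-! ### The parameters of procedure A -/

/-- `v 0` and `v 1` have the inner products of the vectors `(x, 0, ±z)`. -/
structure IsGram (v : Fin 2 → E3) (x z : ℝ) : Prop where
  norm_sq : ∀ i, ‖v i‖ ^ 2 = x ^ 2 + z ^ 2
  inner_eq : inner ℝ (v 0) (v 1) = x ^ 2 - z ^ 2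

namespace IsGram

variable {v : Fin 2 → E3} {x z : ℝ}

lemma inner_apply (h : IsGram v x z) (i j : Fin 2) :
    inner ℝ (v i) (v j) = x ^ 2 + sgn i * sgn j * z ^ 2 := by
  have h0 := h.norm_sq 0
  have h1 := h.norm_sq 1
  have h2 := h.inner_eq
  fin_cases i <;> fin_cases j <;> simp [sgn]
  · exact h0
  · rw [h2]; ring
  · rw [real_inner_comm, h2]; ring
  · exact h1

lemma inner_sub (h : IsGram v x z) (i : Fin 2) :
    inner ℝ (v i) (v 0 - v 1) = sgn i * (2 * z ^ 2) := by
  rw [inner_sub_right, h.inner_apply, h.inner_apply]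
  simp [sgn]
  ring

lemma diffLen_eq (h : IsGram v x z) (hz : 0 ≤ z) : diffLen v = 2 * z := by
  rw [diffLen, ← sq_eq_sq₀ (norm_nonneg _) (by positivity), norm_sub_sq_real, h.norm_sq, h.norm_sq,
    h.inner_eq]
  ring

lemma norm_add_eq (h : IsGram v x z) (hx : 0 ≤ x) : ‖v 0 + v 1‖ = 2 * x := by
  rw [← sq_eq_sq₀ (norm_nonneg _) (by positivity), norm_add_sq_real, h.norm_sq, h.norm_sq,
    h.inner_eq]
  ring

/-- Lagrange's identity evaluates the length of the cross product. -/
lemma crossLen_eq (h : IsGram v x z) (hx : 0 ≤ x) (hz : 0 ≤ z) : crossLen v = 2 * x * z := by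
  have h0 := h.norm_sq 0
  have h1 := h.norm_sq 1
  have h2 := h.inner_eq
  rw [norm_sq_eq] at h0 h1
  rw [QubitTracking.inner_eq] at h2
  rw [crossLen, ← sq_eq_sq₀ (norm_nonneg _) (by positivity), norm_sq_eq]
  have lagrange : ∀ x₀ x₁ x₂ y₀ y₁ y₂ : ℝ, (x₁ * y₂ - x₂ * y₁) ^ 2 + (x₂ * y₀ - x₀ * y₂) ^ 2
      + (x₀ * y₁ - x₁ * y₀) ^ 2 = (x₀ ^ 2 + x₁ ^ 2 + x₂ ^ 2) * (y₀ ^ 2 + y₁ ^ 2 + y₂ ^ 2)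
        - (x₀ * y₀ + x₁ * y₁ + x₂ * y₂) ^ 2 := by
    intros
    ring
  have hc : ∀ p q : Fin 3 → ℝ, crossProduct p q
      = ![p 1 * q 2 - p 2 * q 1, p 2 * q 0 - p 0 * q 2, p 0 * q 1 - p 1 * q 0] := by
    intro p q
    rw [cross_apply]
  simp only [hc, Matrix.cons_val_zero, Matrix.cons_val_one, Matrix.cons_val]
  rw [lagrange, h0, h1, h2]
  ring

end IsGram

/-- The tracking problem in normal form: the sources have the Bloch vectors `(a, 0, ±b)` and the
targets have the Bloch vectors `(c, 0, ±s)`, each pair up to a rotation of its own. The vectors `r`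
and `t` are those of the sources and those of the targets weighted with the equal priorities. -/
structure NormalForm (a b c s : ℝ) (r t : Fin 2 → E3) : Prop where
  a_nonneg : 0 ≤ a
  a_lt_one : a < 1
  b_pos : 0 < b
  c_nonneg : 0 ≤ c
  s_nonneg : 0 ≤ s
  sq_add_sq : c ^ 2 + s ^ 2 = 1
  src : IsGram r a b
  tgt : IsGram t (c / 2) (s / 2)

/-- The best value of `2 F - 1` that the dual bound allows for without a condition on the sign of
the indicator function. -/
noncomputable def optValue (a b c s : ℝ) : ℝ := √(c ^ 2 + b ^ 2 * s ^ 2 / (1 - a ^ 2))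

namespace NormalForm

variable {a b c s : ℝ} {r t : Fin 2 → E3}

lemma one_sub_sq_pos (h : NormalForm a b c s r t) : 0 < 1 - a ^ 2 := by
  nlinarith [h.a_nonneg, h.a_lt_one]

lemma crossLen_src (h : NormalForm a b c s r t) : crossLen r = 2 * a * b :=
  h.src.crossLen_eq h.a_nonneg h.b_pos.le

lemma crossLen_tgt (h : NormalForm a b c s r t) : crossLen t = c * s / 2 := by
  rw [h.tgt.crossLen_eq (by linarith [h.c_nonneg]) (by linarith [h.s_nonneg])]
  ring

lemma quantT_eq (h : NormalForm a b c s r t) :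
    quantT r t = c ^ 2 * (1 - a ^ 2) - b ^ 2 * s ^ 2 := by
  simp only [quantT, Fin.sum_univ_two, h.src.inner_apply, h.tgt.inner_apply]
  simp [sgn]
  ring

lemma quantS_eq (h : NormalForm a b c s r t) :
    quantS r t = c ^ 2 * (1 - a ^ 2) + b ^ 2 * s ^ 2 := by
  have hE := h.one_sub_sq_pos
  rw [quantS, h.quantT_eq, h.crossLen_tgt, h.crossLen_src, h.src.diffLen_eq h.b_pos.le,
    ← Real.sqrt_sq (show 0 ≤ c ^ 2 * (1 - a ^ 2) + b ^ 2 * s ^ 2 by positivity)]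
  congr 1
  ring

lemma quantS_add_quantT (h : NormalForm a b c s r t) :
    quantS r t + quantT r t = 2 * (c ^ 2 * (1 - a ^ 2)) := by
  rw [h.quantS_eq, h.quantT_eq]
  ring

lemma omegaVec_eq (h : NormalForm a b c s r t) :
    omegaVec r t = 2 * (c ^ 2 * (1 - a ^ 2) - a * b * c * s) := by
  rw [omegaVec, h.quantS_add_quantT, h.crossLen_tgt, h.crossLen_src]
  ring

lemma optValue_sq (h : NormalForm a b c s r t) :
    optValue a b c s ^ 2 = c ^ 2 + b ^ 2 * s ^ 2 / (1 - a ^ 2) := by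
  have hE := h.one_sub_sq_pos
  exact Real.sq_sqrt (by positivity)

lemma quantS_eq_optValue (h : NormalForm a b c s r t) :
    quantS r t = optValue a b c s ^ 2 * (1 - a ^ 2) := by
  have hE := h.one_sub_sq_pos
  rw [h.optValue_sq, h.quantS_eq]
  field_simp

lemma optValue_pos (h : NormalForm a b c s r t) (hc : 0 < c) : 0 < optValue a b c s := by
  have hE := h.one_sub_sq_pos
  exact Real.sqrt_pos.mpr (by positivity)

lemma c_pos (h : NormalForm a b c s r t) (hΩ : 0 < omegaVec r t) : 0 < c := by
  rcases h.c_nonneg.eq_or_lt with hc | hc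
  · rw [h.omegaVec_eq, ← hc] at hΩ
    simp at hΩ
  · exact hc

lemma sqrt_two_div (h : NormalForm a b c s r t) (hc : 0 < c) :
    √(2 / (quantS r t * (quantS r t + quantT r t)))
      = 1 / (optValue a b c s * c * (1 - a ^ 2)) := by
  have hE := h.one_sub_sq_pos
  have hP := h.optValue_pos hc
  rw [h.quantS_add_quantT, h.quantS_eq_optValue,
    ← Real.sqrt_sq (show 0 ≤ 1 / (optValue a b c s * c * (1 - a ^ 2)) by positivity)]
  congr 1
  field_simp

lemma mu2_eq (h : NormalForm a b c s r t) (hc : 0 < c) :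
    mu2 r t = a * b * s / (c * (1 - a ^ 2)) := by
  have hE := h.one_sub_sq_pos
  rw [mu2, h.quantS_add_quantT, h.crossLen_tgt, h.crossLen_src]
  field_simp

lemma mu3_eq (h : NormalForm a b c s r t) (hc : 0 < c) :
    mu3 r t = b * s / (optValue a b c s * (1 - a ^ 2)) := by
  have hE := h.one_sub_sq_pos
  have hP := h.optValue_pos hc
  rw [mu3, h.sqrt_two_div hc, h.crossLen_tgt, h.src.diffLen_eq h.b_pos.le]
  field_simp

lemma mu1_eq (h : NormalForm a b c s r t) (hc : 0 < c) : mu1 r t = mu2 r t * mu3 r t := by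
  have hE := h.one_sub_sq_pos
  have hP := h.optValue_pos hc
  have hsq : √(2 / (quantS r t * (quantS r t + quantT r t) ^ 3))
      = 1 / (2 * optValue a b c s * c ^ 3 * (1 - a ^ 2) ^ 2) := by
    rw [h.quantS_add_quantT, h.quantS_eq_optValue, ← Real.sqrt_sq
      (show 0 ≤ 1 / (2 * optValue a b c s * c ^ 3 * (1 - a ^ 2) ^ 2) by positivity)]
    congr 1
    field_simp
  rw [mu1, hsq, h.mu2_eq hc, h.mu3_eq hc, h.crossLen_tgt, h.crossLen_src,
    h.src.diffLen_eq h.b_pos.le]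
  field_simp

lemma s1_eq (h : NormalForm a b c s r t) (hc : 0 < c) :
    s1 r t = (c ^ 2 * (1 - a ^ 2) ^ 2 - a ^ 2 * b ^ 2 * s ^ 2)
      / (optValue a b c s * c * (1 - a ^ 2) ^ 2) := by
  have hE := h.one_sub_sq_pos
  have hP := h.optValue_pos hc
  have hsq : √(1 / (2 * quantS r t * (quantS r t + quantT r t) ^ 3))
      = 1 / (4 * optValue a b c s * c ^ 3 * (1 - a ^ 2) ^ 2) := by
    rw [h.quantS_add_quantT, h.quantS_eq_optValue, ← Real.sqrt_sq
      (show 0 ≤ 1 / (4 * optValue a b c s * c ^ 3 * (1 - a ^ 2) ^ 2) by positivity)]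
    congr 1
    field_simp
    norm_num
  rw [s1, hsq, h.quantS_add_quantT, h.crossLen_tgt, h.crossLen_src]
  field_simp
  ring

lemma alphaA_eq (h : NormalForm a b c s r t) (hc : 0 < c) :
    alphaA r t = c / optValue a b c s := by
  have hE := h.one_sub_sq_pos
  have hP := h.optValue_pos hc
  rw [alphaA, h.quantS_add_quantT, h.quantS_eq_optValue,
    ← Real.sqrt_sq (show 0 ≤ c / optValue a b c s by positivity)]
  congr 1
  field_simp

lemma betaA_eq (h : NormalForm a b c s r t) (hc : 0 < c) (i : Fin 2) :
    betaA r t i = sgn i * (2 * b ^ 2 / (optValue a b c s * c * (1 - a ^ 2))) := by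
  have hE := h.one_sub_sq_pos
  have hP := h.optValue_pos hc
  rw [betaA, h.sqrt_two_div hc, h.src.inner_sub]
  field_simp

/-- The common `x` component of the outputs is `α`. -/
lemma s1_add_mu1_mul (h : NormalForm a b c s r t) (hc : 0 < c) :
    s1 r t + mu1 r t * a = alphaA r t := by
  have hE := h.one_sub_sq_pos
  have hP := h.optValue_pos hc
  rw [h.s1_eq hc, h.mu1_eq hc, h.mu2_eq hc, h.mu3_eq hc, h.alphaA_eq hc]
  field_simp
  ring

lemma mu3_mul (h : NormalForm a b c s r t) (hc : 0 < c) :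
    mu3 r t * b = betaA r t 0 * c * s / 2 := by
  have hE := h.one_sub_sq_pos
  have hP := h.optValue_pos hc
  rw [h.mu3_eq hc, h.betaA_eq hc]
  simp [sgn]
  field_simp

/-- The outputs `(α, 0, ±β₁ c s / 2)` attain the dual bound. -/
lemma alphaA_mul_add (h : NormalForm a b c s r t) (hc : 0 < c) :
    alphaA r t * c + betaA r t 0 * c * s ^ 2 / 2 = optValue a b c s := by
  have hE := h.one_sub_sq_pos
  have hP := h.optValue_pos hc
  have h2 := h.optValue_sq
  rw [h.alphaA_eq hc, h.betaA_eq hc]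
  simp only [sgn, Matrix.cons_val_zero, one_mul]
  have : c / optValue a b c s * c
      + 2 * b ^ 2 / (optValue a b c s * c * (1 - a ^ 2)) * c * s ^ 2 / 2
      = optValue a b c s ^ 2 / optValue a b c s := by
    rw [h2]
    field_simp
  rw [this]
  field_simp

/-- The final rotation takes `(1, 0, 0)` and `(0, 0, 1)` to the directions of `t₁ + t₂` and of
`t₁ - t₂`. -/
lemma kCoeff_eq (h : NormalForm a b c s r t) (hc : 0 < c) (i j : Fin 2) :
    kCoeff t (alphaA r t) (betaA r t) i j
      = alphaA r t / c + sgn i * sgn j * (betaA r t 0 * c / 2) := by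
  have hE := h.one_sub_sq_pos
  have hP := h.optValue_pos hc
  have hb := h.b_pos
  have hs := h.sq_add_sq
  have hα : 0 < alphaA r t := by
    rw [h.alphaA_eq hc]
    positivity
  have hβ : 0 < betaA r t 0 := by
    rw [h.betaA_eq hc]
    simp only [sgn, Matrix.cons_val_zero, one_mul]
    positivity
  have hβi : ∀ i, betaA r t i = sgn i * betaA r t 0 := by
    intro i
    rw [h.betaA_eq hc, h.betaA_eq hc 0]
    simp [sgn]
  set α := alphaA r t
  set β := betaA r t 0
  have h1 : betaA r t 1 = -β := by
    rw [hβi 1]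
    simp [sgn]
  have hΓ : gammaNorm t α (betaA r t) = c * (α + β * s ^ 2 / 2) := by
    rw [gammaNorm, h.tgt.norm_add_eq (by positivity), h1, h.crossLen_tgt,
      ← Real.sqrt_sq (show 0 ≤ c * (α + β * s ^ 2 / 2) by positivity)]
    have hd : ‖betaA r t 0 • t 0 + -β • t 1‖ ^ 2 = β ^ 2 * s ^ 2 := by
      have : betaA r t 0 • t 0 + -β • t 1 = β • (t 0 - t 1) := by
        rw [smul_sub, neg_smul, sub_eq_add_neg]
      have hdl : ‖t 0 - t 1‖ = 2 * (s / 2) := h.tgt.diffLen_eq (by linarith [h.s_nonneg])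
      rw [this, norm_smul, mul_pow, hdl, Real.norm_eq_abs, sq_abs]
      ring
    rw [hd]
    congr 1
    ring
  have hpos : 0 < α + β * s ^ 2 / 2 := by positivity
  rw [kCoeff, hΓ, h1, h.crossLen_tgt, h.tgt.inner_apply, hβi i, hβi j]
  have hs2 : s ^ 2 = 1 - c ^ 2 := by linarith
  change 1 / (c * (α + β * s ^ 2 / 2)) * (α ^ 2 + sgn i * β * (sgn j * β) * (c * s / 2) ^ 2
    + _ * α * (β - -β) * _) = _
  rw [one_div, inv_mul_eq_div, div_eq_iff (by positivity)]
  fin_cases i <;> fin_cases j <;> simp [sgn, Fin.rev] <;> field_simp <;>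
    simp only [hs2] <;> ring

end NormalForm

/-! ### Optimal operations -/

/-- The two Kraus operators of the contraction of the Bloch ball in procedure A, in terms of the
half-angles of `m₂ = cos u` and `m₃ = cos v`. They are
`cos (u/2) cos (v/2) + sin (u/2) sin (v/2) X` and, up to the phase `i`,
`cos (u/2) sin (v/2) Y + i sin (u/2) cos (v/2) Z`. -/
noncomputable def contractionKraus (u v : ℝ) : Fin 2 → Qubit :=
  ![!![((Real.cos (u / 2) * Real.cos (v / 2) : ℝ) : ℂ),
      ((Real.sin (u / 2) * Real.sin (v / 2) : ℝ) : ℂ);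
      ((Real.sin (u / 2) * Real.sin (v / 2) : ℝ) : ℂ),
      ((Real.cos (u / 2) * Real.cos (v / 2) : ℝ) : ℂ)],
    !![((Real.cos (v / 2) * Real.sin (u / 2) : ℝ) : ℂ),
      ((-(Real.sin (v / 2) * Real.cos (u / 2)) : ℝ) : ℂ);
      ((Real.sin (v / 2) * Real.cos (u / 2) : ℝ) : ℂ),
      ((-(Real.cos (v / 2) * Real.sin (u / 2)) : ℝ) : ℂ)]]

lemma affineMap_cos_eq (u v : ℝ) (A : Qubit) :
    affineMap (Real.cos u * Real.cos v) (Real.cos u) (Real.cos v) (Real.sin u * Real.sin v) A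
      = ∑ k, contractionKraus u v k * A * (contractionKraus u v k)ᴴ := by
  have half : ∀ x : ℝ, ∃ p q : ℝ, p = Real.cos (x / 2) ∧ q = Real.sin (x / 2) ∧
      p ^ 2 + q ^ 2 = 1 ∧ Real.cos x = p ^ 2 - q ^ 2 ∧ Real.sin x = 2 * q * p := by
    intro x
    refine ⟨_, _, rfl, rfl, Real.cos_sq_add_sin_sq _, ?_, ?_⟩
    · rw [← Real.cos_two_mul']
      ring_nf
    · rw [← Real.sin_two_mul]
      ring_nf
  obtain ⟨p, q, hp, hq, hpq, hcu, hsu⟩ := half u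
  obtain ⟨p', q', hp', hq', hpq', hcv, hsv⟩ := half v
  have e1 : (p : ℂ) ^ 2 = 1 - (q : ℂ) ^ 2 := by
    rw [eq_sub_iff_add_eq]
    exact_mod_cast hpq
  have e2 : (p' : ℂ) ^ 2 = 1 - (q' : ℂ) ^ 2 := by
    rw [eq_sub_iff_add_eq]
    exact_mod_cast hpq'
  have hX : (pauliX * A).trace = A 1 0 + A 0 1 := by
    simp [pauliX, -Matrix.cons_mul, Matrix.trace_fin_two, Matrix.mul_apply, Fin.sum_univ_two]
  have hY : (pauliY * A).trace = Complex.I * (A 0 1 - A 1 0) := by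
    simp [pauliY, -Matrix.cons_mul, Matrix.trace_fin_two, Matrix.mul_apply, Fin.sum_univ_two]
    ring
  have hZ : (pauliZ * A).trace = A 0 0 - A 1 1 := by
    simp [pauliZ, -Matrix.cons_mul, Matrix.trace_fin_two, Matrix.mul_apply, Fin.sum_univ_two]
    ring
  rw [affineMap, hX, hY, hZ, Fin.sum_univ_two, hcu, hsu, hcv, hsv, contractionKraus, ← hp, ← hq,
    ← hp', ← hq', Matrix.trace_fin_two]
  ext i j
  rw [Matrix.add_apply, conj_apply, conj_apply]
  fin_cases i <;> fin_cases j <;>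
    simp [pauliX, pauliY, pauliZ, Complex.conj_ofReal] <;> ring_nf <;>
    simp only [Complex.I_sq, e1, e2] <;> ring

/-- `affineMap (m₂ m₃) m₂ m₃ s` has a Kraus representation if `m₂` and `m₃` are cosines and `s` is
the product of the corresponding sines. Such maps are extreme points of the set of quantum
operations. -/
lemma exists_kraus_affineMap {m₂ m₃ s : ℝ} (h2 : |m₂| ≤ 1) (h3 : |m₃| ≤ 1) (hs0 : 0 ≤ s)
    (hs : s ^ 2 = (1 - m₂ ^ 2) * (1 - m₃ ^ 2)) :
    ∃ K : Fin 2 → Qubit, ∀ A, affineMap (m₂ * m₃) m₂ m₃ s A = ∑ k, K k * A * (K k)ᴴ := by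
  obtain ⟨h2l, h2u⟩ := abs_le.mp h2
  obtain ⟨h3l, h3u⟩ := abs_le.mp h3
  have hsin : s = Real.sin (Real.arccos m₂) * Real.sin (Real.arccos m₃) := by
    rw [Real.sin_arccos, Real.sin_arccos, ← Real.sqrt_mul (by nlinarith), ← hs, Real.sqrt_sq hs0]
  refine ⟨contractionKraus (Real.arccos m₂) (Real.arccos m₃), fun A => ?_⟩
  rw [← affineMap_cos_eq, hsin, Real.cos_arccos h2l h2u, Real.cos_arccos h3l h3u]

lemma trace_affineMap (m₁ m₂ m₃ s : ℝ) (A : Qubit) : (affineMap m₁ m₂ m₃ s A).trace = A.trace := by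
  simp [affineMap, Matrix.trace_fin_two, pauliX, pauliY, pauliZ]
  ring

lemma affineMap_planar (m₁ m₂ m₃ s x z : ℝ) :
    affineMap m₁ m₂ m₃ s (planar x z) = planar (s + m₁ * x) (m₃ * z) := by
  have h1 : (pauliX * planar x z).trace = x := by
    simp [planar, pauliX, Matrix.trace_fin_two]
  have h2 : (pauliY * planar x z).trace = 0 := by
    simp [planar, pauliY, Matrix.trace_fin_two]
  have h3 : (pauliZ * planar x z).trace = z := by
    simp [planar, pauliZ, Matrix.trace_fin_two]
    ring
  rw [affineMap, h1, h2, h3, trace_planar]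
  ext i j
  fin_cases i <;> fin_cases j <;> simp [planar, pauliX, pauliY, pauliZ] <;> ring

/-- A pair of qubit states with the Gram matrix of `(x, 0, ±z)` can be rotated to these Bloch
vectors. -/
lemma exists_isFrame {ρ : Fin 2 → Qubit} {x z : ℝ} (hH : ∀ i, (ρ i).IsHermitian)
    (h1 : ∀ i, (ρ i).trace = 1) (hg : IsGram (fun i => bloch (ρ i)) x z) (hx : 0 ≤ x)
    (hz : 0 ≤ z) : ∃ V, IsFrame V ρ x z := by
  have huv : inner ℝ (bloch (ρ 0) + bloch (ρ 1)) (bloch (ρ 0) - bloch (ρ 1)) = 0 := by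
    have e0 := hg.inner_sub 0
    have e1 := hg.inner_sub 1
    rw [inner_add_left, e0, e1]
    simp [sgn]
  obtain ⟨f, ⟨V, hV, hf⟩, hu, hv⟩ := exists_rotation_to_xz huv
  have hn : ‖bloch (ρ 0) + bloch (ρ 1)‖ = 2 * x := hg.norm_add_eq hx
  have hd : ‖bloch (ρ 0) - bloch (ρ 1)‖ = 2 * z := hg.diffLen_eq hz
  have hneg : bloch (-ρ 1) = -bloch (ρ 1) := by
    have := bloch_ofReal_smul (-1) (ρ 1)
    simpa using this
  have hadd : bloch (V * ρ 0 * Vᴴ) + bloch (V * ρ 1 * Vᴴ) = !₂[2 * x, 0, 0] := by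
    rw [← bloch_add, ← add_mul, ← mul_add, hf, bloch_add, hu, hn]
  have hsub : bloch (V * ρ 0 * Vᴴ) - bloch (V * ρ 1 * Vᴴ) = !₂[0, 0, 2 * z] := by
    have e : bloch (V * -ρ 1 * Vᴴ) = -bloch (V * ρ 1 * Vᴴ) := by
      have := bloch_ofReal_smul (-1) (V * ρ 1 * Vᴴ)
      simpa using this
    rw [sub_eq_add_neg, ← e, ← bloch_add, ← add_mul, ← mul_add, hf, bloch_add, hneg,
      ← sub_eq_add_neg, hv, hd]
  have hVV : Vᴴ * V = 1 := Matrix.mem_unitaryGroup_iff'.mp hV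
  refine ⟨V, hV, fun i => eq_of_bloch_eq ?_ (isHermitian_planar _ _) ?_ ?_⟩
  · exact Matrix.isHermitian_mul_mul_conjTranspose V (hH i)
  · rw [Matrix.trace_mul_comm, ← mul_assoc, hVV, one_mul, h1, trace_planar]
  · rw [bloch_planar]
    have ha := fun k => congrArg (fun v : E3 => v k) hadd
    have hb := fun k => congrArg (fun v : E3 => v k) hsub
    have a0 := ha 0
    have a1 := ha 1
    have a2 := ha 2
    have b0 := hb 0
    have b1 := hb 1
    have b2 := hb 2
    simp at a0 a1 a2 b0 b1 b2
    fin_cases i <;> apply E3.ext <;> simp [sgn] <;> linarith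

/-- The tracking problem of two qubit states with equal priorities whose sources have the Gram
matrix of `(a, 0, ±b)` and whose targets have the Gram matrix of `(c, 0, ±s)`. -/
structure PlanarProblem (a b c s : ℝ) (ρ τ : Fin 2 → Qubit) : Prop where
  a_nonneg : 0 ≤ a
  a_lt_one : a < 1
  b_pos : 0 < b
  c_nonneg : 0 ≤ c
  s_nonneg : 0 ≤ s
  sq_add_sq : c ^ 2 + s ^ 2 = 1
  src_isHermitian : ∀ i, (ρ i).IsHermitian
  src_trace : ∀ i, (ρ i).trace = 1
  tgt_isHermitian : ∀ i, (τ i).IsHermitian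
  tgt_trace : ∀ i, (τ i).trace = 1
  src_gram : IsGram (fun i => bloch (ρ i)) a b
  tgt_gram : IsGram (fun i => bloch (τ i)) c s

namespace PlanarProblem

variable {a b c s : ℝ} {ρ τ : Fin 2 → Qubit}

lemma normalForm (h : PlanarProblem a b c s ρ τ) :
    NormalForm a b c s (srcVec ρ) (tgtVec equalPriority τ) where
  a_nonneg := h.a_nonneg
  a_lt_one := h.a_lt_one
  b_pos := h.b_pos
  c_nonneg := h.c_nonneg
  s_nonneg := h.s_nonneg
  sq_add_sq := h.sq_add_sq
  src := h.src_gram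
  tgt := by
    constructor
    · intro i
      have := h.tgt_gram.norm_sq i
      simp only [tgtVec, equalPriority, norm_smul, mul_pow, this]
      norm_num
      ring
    · have := h.tgt_gram.inner_eq
      simp only [tgtVec, equalPriority, inner_smul_left, inner_smul_right, this]
      simp
      ring

lemma Omega_eq (h : PlanarProblem a b c s ρ τ) :
    Omega equalPriority ρ τ = 2 * (c ^ 2 * (1 - a ^ 2) - a * b * c * s) := h.normalForm.omegaVec_eq

lemma exists_src_frame (h : PlanarProblem a b c s ρ τ) : ∃ V, IsFrame V ρ a b :=
  exists_isFrame h.src_isHermitian h.src_trace h.src_gram h.a_nonneg h.b_pos.le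

lemma exists_tgt_frame (h : PlanarProblem a b c s ρ τ) : ∃ W, IsFrame W τ c s :=
  exists_isFrame h.tgt_isHermitian h.tgt_trace h.tgt_gram h.c_nonneg h.s_nonneg

/-- The average fidelity in terms of Bloch vectors. -/
lemma avgFidelity_eq (h : PlanarProblem a b c s ρ τ) {C : Qubit →CP Qubit} (hC : C ∈ cptp) :
    avgFidelity equalPriority ρ τ C = 1 / 2 + 1 / 4 * (inner ℝ (bloch (C (ρ 0))) (bloch (τ 0))
      + inner ℝ (bloch (C (ρ 1))) (bloch (τ 1))) := by
  have hH : ∀ i, (C (ρ i)).IsHermitian := by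
    intro i
    obtain ⟨K, hK⟩ := exists_kraus C
    rw [hK, Matrix.IsHermitian, Matrix.conjTranspose_sum]
    exact Finset.sum_congr rfl fun k _ =>
      Matrix.isHermitian_mul_mul_conjTranspose (K k) (h.src_isHermitian i)
  have ht : ∀ i, (C (ρ i)).trace = 1 := fun i => by rw [hC, h.src_trace]
  rw [avgFidelity_equalPriority,
    trace_mul_re_eq (hH 0) (h.tgt_isHermitian 0) (ht 0) (h.tgt_trace 0),
    trace_mul_re_eq (hH 1) (h.tgt_isHermitian 1) (ht 1) (h.tgt_trace 1)]
  ring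

lemma avgFidelity_le (h : PlanarProblem a b c s ρ τ) {C : Qubit →CP Qubit} (hC : C ∈ cptp) :
    avgFidelity equalPriority ρ τ C ≤ 1 / 2 + 1 / 2 * optValue a b c s := by
  obtain ⟨V, hV⟩ := h.exists_src_frame
  obtain ⟨W, hW⟩ := h.exists_tgt_frame
  exact (dualFeasible_sqrt h.a_nonneg h.a_lt_one h.c_nonneg).avgFidelity_le hV hW hC

/-- The outputs prescribed by procedure A determine its average fidelity. -/
lemma avgFidelity_of_isProcedureA (h : PlanarProblem a b c s ρ τ) (hc : 0 < c)
    {C : Qubit →CP Qubit} (hC : C ∈ cptp) (hA : IsProcedureA equalPriority ρ τ C) :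
    avgFidelity equalPriority ρ τ C = 1 / 2 + 1 / 2 * optValue a b c s := by
  obtain ⟨U, -, V, -, -, hU, hCA⟩ := hA
  have hb : ∀ i, inner ℝ (bloch (C (ρ i))) (bloch (τ i)) = optValue a b c s := by
    intro i
    have ht : bloch (τ i) = (2 : ℝ) • tgtVec equalPriority τ i := by
      simp [tgtVec, equalPriority, smul_smul]
    rw [hCA, hU, ht, inner_smul_right, inner_add_left, inner_smul_left, inner_smul_left,
      h.normalForm.kCoeff_eq hc, h.normalForm.kCoeff_eq hc, h.normalForm.tgt.inner_apply,
      h.normalForm.tgt.inner_apply, ← h.normalForm.alphaA_mul_add hc]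
    fin_cases i <;> simp [sgn] <;> field_simp <;> ring
  rw [h.avgFidelity_eq hC, hb, hb]
  ring

/-- A positive indicator makes the contraction of procedure A a quantum operation. -/
lemma exists_kraus_contraction (h : PlanarProblem a b c s ρ τ)
    (hΩ : 0 < Omega equalPriority ρ τ) :
    ∃ K : Fin 2 → Qubit, ∀ A, affineMap (mu1 (srcVec ρ) (tgtVec equalPriority τ))
      (mu2 (srcVec ρ) (tgtVec equalPriority τ)) (mu3 (srcVec ρ) (tgtVec equalPriority τ))
      (s1 (srcVec ρ) (tgtVec equalPriority τ)) A = ∑ k, K k * A * (K k)ᴴ := by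
  have hn := h.normalForm
  have hc := hn.c_pos hΩ
  have hE := hn.one_sub_sq_pos
  have hP := hn.optValue_pos hc
  have hb := h.b_pos
  have ha := h.a_nonneg
  have hs := h.s_nonneg
  rw [h.Omega_eq] at hΩ
  have hlt : a * b * s ≤ c * (1 - a ^ 2) := by
    refine le_of_mul_le_mul_left (a := c) ?_ hc
    linarith
  have hsq : (a * b * s) ^ 2 ≤ (c * (1 - a ^ 2)) ^ 2 := by gcongr
  have hP2 : optValue a b c s ^ 2 * (1 - a ^ 2) = c ^ 2 * (1 - a ^ 2) + b ^ 2 * s ^ 2 := by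
    rw [← hn.quantS_eq_optValue, hn.quantS_eq]
  rw [hn.mu1_eq hc]
  refine exists_kraus_affineMap ?_ ?_ ?_ ?_
  · rw [hn.mu2_eq hc, abs_of_nonneg (by positivity), div_le_one (by positivity)]
    exact hlt
  · rw [hn.mu3_eq hc, abs_of_nonneg (by positivity), div_le_one (by positivity)]
    refine (sq_le_sq₀ (by positivity) (by positivity)).mp ?_
    have : (optValue a b c s * (1 - a ^ 2)) ^ 2
        = (c ^ 2 * (1 - a ^ 2) + b ^ 2 * s ^ 2) * (1 - a ^ 2) := by
      rw [← hP2]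
      ring
    rw [this]
    linarith
  · rw [hn.s1_eq hc]
    refine div_nonneg ?_ (by positivity)
    linarith
  · rw [hn.s1_eq hc, hn.mu2_eq hc, hn.mu3_eq hc]
    have h3 : 1 - (b * s / (optValue a b c s * (1 - a ^ 2))) ^ 2
        = (c ^ 2 * (1 - a ^ 2) ^ 2 - a ^ 2 * b ^ 2 * s ^ 2)
          / (optValue a b c s * (1 - a ^ 2)) ^ 2 := by
      rw [div_pow, eq_div_iff (by positivity), sub_mul, div_mul_cancel₀ _ (by positivity)]
      linear_combination (1 - a ^ 2) * hP2
    rw [h3]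
    field_simp

theorem exists_isProcedureA (h : PlanarProblem a b c s ρ τ) (hΩ : 0 < Omega equalPriority ρ τ) :
    ∃ C ∈ cptp, IsProcedureA equalPriority ρ τ C := by
  obtain ⟨V, hV⟩ := h.exists_src_frame
  obtain ⟨W, hW⟩ := h.exists_tgt_frame
  obtain ⟨K, hK⟩ := h.exists_kraus_contraction hΩ
  have hn := h.normalForm
  have hc := hn.c_pos hΩ
  have hCA : ∀ A, krausMap (fun k => Wᴴ * K k * V) A = Wᴴ * affineMap
      (mu1 (srcVec ρ) (tgtVec equalPriority τ)) (mu2 (srcVec ρ) (tgtVec equalPriority τ))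
      (mu3 (srcVec ρ) (tgtVec equalPriority τ)) (s1 (srcVec ρ) (tgtVec equalPriority τ))
      (V * A * Vᴴ) * Wᴴᴴ := by
    intro A
    rw [hK, krausMap_apply, Finset.mul_sum, Finset.sum_mul]
    refine Finset.sum_congr rfl fun k _ => ?_
    simp only [Matrix.conjTranspose_mul, mul_assoc]
  refine ⟨krausMap fun k => Wᴴ * K k * V, ?_, Wᴴ, Unitary.star_mem hW.mem, V, hV.mem, ?_, ?_, hCA⟩
  · intro A
    rw [hCA, Matrix.trace_mul_comm, ← mul_assoc, Matrix.conjTranspose_conjTranspose,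
      hW.mul_conjTranspose_self, one_mul, trace_affineMap, Matrix.trace_mul_comm, ← mul_assoc,
      hV.conjTranspose_mul_self, one_mul]
  · intro i
    rw [hV.conj_eq, bloch_planar, hn.crossLen_src, hn.src.diffLen_eq h.b_pos.le, hn.src.inner_sub]
    have hb := h.b_pos
    congr 2
    · field_simp
    · field_simp
  · intro i
    rw [hV.conj_eq, affineMap_planar, hn.s1_add_mu1_mul hc, hn.kCoeff_eq hc, hn.kCoeff_eq hc,
      show mu3 (srcVec ρ) (tgtVec equalPriority τ) * (sgn i * b)
        = sgn i * (mu3 (srcVec ρ) (tgtVec equalPriority τ) * b) by ring, hn.mu3_mul hc]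
    set α := alphaA (srcVec ρ) (tgtVec equalPriority τ)
    set β := betaA (srcVec ρ) (tgtVec equalPriority τ) 0
    -- The output is a combination of the rotated targets and of the identity.
    have hcomb : planar α (sgn i * (β * c * s / 2))
        = ((1 / 2 * (α / c + sgn i * sgn 0 * (β * c / 2)) : ℝ) : ℂ) • planar c (sgn 0 * s)
          + ((1 / 2 * (α / c + sgn i * sgn 1 * (β * c / 2)) : ℝ) : ℂ) • planar c (sgn 1 * s)
          + ((1 / 2 - α / (2 * c) : ℝ) : ℂ) • 1 := by
      have hc' : (c : ℂ) ≠ 0 := by exact_mod_cast hc.ne'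
      ext k l
      fin_cases k <;> fin_cases l <;> simp [planar, sgn] <;> field_simp <;> ring
    rw [hcomb, ← hW.conj_eq, ← hW.conj_eq]
    have hback : ∀ A : Qubit, Wᴴ * (W * A * Wᴴ) * W = A := by
      intro A
      calc Wᴴ * (W * A * Wᴴ) * W = (Wᴴ * W) * A * (Wᴴ * W) := by simp only [mul_assoc]
        _ = A := by rw [hW.conjTranspose_mul_self, one_mul, mul_one]
    simp only [mul_add, add_mul, Matrix.mul_smul, Matrix.smul_mul,
      Matrix.conjTranspose_conjTranspose, hback, mul_one, hW.conjTranspose_mul_self]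
    rw [bloch_add, bloch_add, bloch_ofReal_smul, bloch_ofReal_smul, bloch_ofReal_smul, bloch_one,
      smul_zero, add_zero]
    simp only [tgtVec, equalPriority, smul_smul]
    congr 2 <;> ring

theorem isGreatest_of_pos (h : PlanarProblem a b c s ρ τ) (hΩ : 0 < Omega equalPriority ρ τ) :
    IsGreatest (achievable equalPriority ρ τ) (1 / 2 + 1 / 2 * optValue a b c s) ∧
      (∃ C ∈ cptp, IsProcedureA equalPriority ρ τ C) ∧
      ∀ C ∈ cptp, IsProcedureA equalPriority ρ τ C → IsOptimal equalPriority ρ τ C := by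
  have hc := h.normalForm.c_pos hΩ
  obtain ⟨C, hC, hA⟩ := h.exists_isProcedureA hΩ
  refine ⟨⟨⟨C, hC, h.avgFidelity_of_isProcedureA hc hC hA⟩, ?_⟩, ⟨C, hC, hA⟩, ?_⟩
  · rintro _ ⟨C', hC', rfl⟩
    exact h.avgFidelity_le hC'
  · intro C hC hA
    refine ⟨hC, fun C' hC' => ?_⟩
    rw [h.avgFidelity_of_isProcedureA hc hC hA]
    exact h.avgFidelity_le hC'

/-- For a non-positive indicator the rotation that aligns the two configurations is optimal. -/
theorem isGreatest_of_nonpos (h : PlanarProblem a b c s ρ τ)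
    (hΩ : Omega equalPriority ρ τ ≤ 0) :
    IsGreatest (achievable equalPriority ρ τ) (1 / 2 + 1 / 2 * (a * c + b * s)) ∧
      ∃ C, IsUnitaryOperation C ∧ IsOptimal equalPriority ρ τ C := by
  obtain ⟨V, hV⟩ := h.exists_src_frame
  obtain ⟨W, hW⟩ := h.exists_tgt_frame
  rw [h.Omega_eq] at hΩ
  have hdual := dualFeasible_unitary h.a_nonneg h.b_pos h.a_lt_one h.c_nonneg h.s_nonneg
    (by linarith)
  have hU : Wᴴ * V ∈ Matrix.unitaryGroup (Fin 2) ℂ := mul_mem (Unitary.star_mem hW.mem) hV.mem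
  have hCA : ∀ A, krausMap (fun _ : Unit => Wᴴ * V) A = (Wᴴ * V) * A * (Wᴴ * V)ᴴ := by
    intro A
    simp [krausMap_apply]
  have hC : krausMap (fun _ : Unit => Wᴴ * V) ∈ cptp := krausMap_mem_cptp <| by
    rw [Fintype.sum_unique]
    exact Matrix.mem_unitaryGroup_iff'.mp hU
  have hF : avgFidelity equalPriority ρ τ (krausMap (fun _ : Unit => Wᴴ * V))
      = 1 / 2 + 1 / 2 * (a * c + b * s) := by
    have htr : ∀ i, ((Wᴴ * V) * ρ i * (Wᴴ * V)ᴴ * τ i).trace.re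
        = (1 + (a * c + b * s)) / 2 := by
      intro i
      have : ((Wᴴ * V) * ρ i * (Wᴴ * V)ᴴ * τ i).trace
          = (planar a (sgn i * b) * planar c (sgn i * s)).trace := by
        rw [← hV.conj_eq, ← hW.conj_eq, Matrix.conjTranspose_mul,
          Matrix.conjTranspose_conjTranspose]
        simp only [mul_assoc]
        rw [Matrix.trace_mul_comm]
        simp only [mul_assoc]
      rw [this, trace_mul_re_eq (isHermitian_planar _ _) (isHermitian_planar _ _)
        (trace_planar _ _) (trace_planar _ _), bloch_planar, bloch_planar, inner_eq]
      fin_cases i <;> simp [sgn]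
    rw [avgFidelity_equalPriority, hCA, hCA, htr, htr]
    ring
  refine ⟨⟨⟨_, hC, hF⟩, ?_⟩, _, ⟨_, hU, hCA⟩, hC, fun C' hC' => ?_⟩
  · rintro _ ⟨C', hC', rfl⟩
    exact hdual.avgFidelity_le hV hW hC'
  · rw [hF]
    exact hdual.avgFidelity_le hV hW hC'

end PlanarProblem

/-! ### The two families of tracking problems -/

lemma isHermitian_ketBra (ψ : Fin 2 → ℂ) : (ketBra ψ).IsHermitian := by
  ext i j
  simp [ketBra, Matrix.vecMulVec_apply, mul_comm]

lemma trace_ketBra (ψ : Fin 2 → ℂ) : (ketBra ψ).trace = star ψ ⬝ᵥ ψ := by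
  simp [ketBra, dotProduct, Fin.sum_univ_two, mul_comm]

lemma IsPureState.isHermitian {ρ : Qubit} (h : IsPureState ρ) : ρ.IsHermitian := by
  obtain ⟨ψ, -, rfl⟩ := h
  exact isHermitian_ketBra ψ

lemma IsPureState.trace_eq_one {ρ : Qubit} (h : IsPureState ρ) : ρ.trace = 1 := by
  obtain ⟨ψ, hψ, rfl⟩ := h
  rw [trace_ketBra, hψ]

/-- Pure states lie on the Bloch sphere. -/
lemma IsPureState.norm_bloch {ρ : Qubit} (h : IsPureState ρ) : ‖bloch ρ‖ = 1 := by
  obtain ⟨ψ, hψ, rfl⟩ := h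
  have h1 := congrArg Complex.re hψ
  simp only [dotProduct, Fin.sum_univ_two, Pi.star_apply, RCLike.star_def, Complex.add_re,
    Complex.mul_re, Complex.conj_re, Complex.conj_im, Complex.one_re] at h1
  rw [← sq_eq_sq₀ (norm_nonneg _) zero_le_one, norm_sq_eq]
  simp only [bloch_apply_zero, bloch_apply_one, bloch_apply_two, ketBra, Matrix.vecMulVec_apply,
    Pi.star_apply, RCLike.star_def, Complex.mul_re, Complex.mul_im, Complex.conj_re,
    Complex.conj_im]
  linear_combination ((ψ 0).re ^ 2 + (ψ 0).im ^ 2 + (ψ 1).re ^ 2 + (ψ 1).im ^ 2 + 1) * h1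

/-- A pair of vectors of equal length is determined up to a rotation by the length and the angle
between the vectors. -/
lemma IsGram.of_angle {v : Fin 2 → E3} {R θ : ℝ} (hn : ∀ i, ‖v i‖ = R)
    (hθ : InnerProductGeometry.angle (v 0) (v 1) = 2 * θ) :
    IsGram v (R * Real.cos θ) (R * Real.sin θ) := by
  constructor
  · intro i
    rw [hn]
    linear_combination -R ^ 2 * Real.sin_sq_add_cos_sq θ
  · rw [← InnerProductGeometry.cos_angle_mul_norm_mul_norm, hθ, hn, hn, Real.cos_two_mul']
    ring

lemma isGram_planar (x z : ℝ) : IsGram (fun i => bloch (planar x (sgn i * z))) x z := by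
  constructor
  · intro i
    rw [norm_sq_eq, bloch_planar]
    fin_cases i <;> simp [sgn]
  · rw [inner_eq, bloch_planar, bloch_planar]
    simp [sgn]
    ring

lemma planarProblem_of_angles {R θ θbar : ℝ} {ρ τ : Fin 2 → Qubit} (hR0 : 0 < R) (hR1 : R < 1)
    (hθ0 : 0 < θ) (hθ1 : θ ≤ Real.pi / 2) (hθb0 : 0 ≤ θbar) (hθb1 : θbar ≤ Real.pi / 2)
    (hρ : ∀ i, IsDensity (ρ i)) (hn : ∀ i, ‖bloch (ρ i)‖ = R)
    (hang : InnerProductGeometry.angle (bloch (ρ 0)) (bloch (ρ 1)) = 2 * θ)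
    (hτ : ∀ i, IsPureState (τ i))
    (hangb : InnerProductGeometry.angle (bloch (τ 0)) (bloch (τ 1)) = 2 * θbar) :
    PlanarProblem (R * Real.cos θ) (R * Real.sin θ) (Real.cos θbar) (Real.sin θbar) ρ τ where
  a_nonneg := mul_nonneg hR0.le (Real.cos_nonneg_of_mem_Icc ⟨by linarith, hθ1⟩)
  a_lt_one := by nlinarith [Real.cos_le_one θ]
  b_pos := mul_pos hR0 (Real.sin_pos_of_pos_of_lt_pi hθ0 (by linarith [Real.pi_pos]))
  c_nonneg := Real.cos_nonneg_of_mem_Icc ⟨by linarith [Real.pi_pos], hθb1⟩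
  s_nonneg := Real.sin_nonneg_of_nonneg_of_le_pi hθb0 (by linarith [Real.pi_pos])
  sq_add_sq := Real.cos_sq_add_sin_sq _
  src_isHermitian i := (hρ i).posSemidef.1
  src_trace i := (hρ i).trace_eq_one
  tgt_isHermitian i := (hτ i).isHermitian
  tgt_trace i := (hτ i).trace_eq_one
  src_gram := IsGram.of_angle hn hang
  tgt_gram := by
    simpa using IsGram.of_angle (fun i => (hτ i).norm_bloch) hangb

lemma prepared_eq (φ : ℝ) (i : Fin 2) :
    prepared φ i = ![(((Real.cos (φ / 2) + sgn i * Real.sin (φ / 2)) / √2 : ℝ) : ℂ),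
      (((Real.cos (φ / 2) - sgn i * Real.sin (φ / 2)) / √2 : ℝ) : ℂ)] := by
  ext j
  fin_cases i <;> fin_cases j <;>
    simp [prepared, ketPlus, ketMinus, sgn, -Complex.ofReal_cos, -Complex.ofReal_sin] <;> ring

lemma ketBra_prepared (φ : ℝ) (i : Fin 2) :
    ketBra (prepared φ i) = planar (Real.cos φ) (sgn i * Real.sin φ) := by
  have h2 : √2 ^ 2 = 2 := Real.sq_sqrt zero_le_two
  have hc : Real.cos φ = Real.cos (φ / 2) ^ 2 - Real.sin (φ / 2) ^ 2 := by
    rw [← Real.cos_two_mul']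
    ring_nf
  have hs : Real.sin φ = 2 * Real.sin (φ / 2) * Real.cos (φ / 2) := by
    rw [← Real.sin_two_mul]
    ring_nf
  have hi : sgn i ^ 2 = 1 := by fin_cases i <;> simp [sgn]
  have h1 := Real.sin_sq_add_cos_sq (φ / 2)
  refine eq_of_bloch_eq (isHermitian_ketBra _) (isHermitian_planar _ _) ?_ ?_
  · rw [trace_planar, trace_ketBra, prepared_eq]
    simp only [dotProduct, Fin.sum_univ_two, Pi.star_apply, Matrix.cons_val_zero,
      Matrix.cons_val_one, Matrix.cons_val_fin_one, RCLike.star_def, Complex.conj_ofReal]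
    norm_cast
    field_simp
    rw [h2]
    linear_combination 2 * Real.sin (φ / 2) ^ 2 * hi + 2 * h1
  · rw [bloch_planar, prepared_eq, hc, hs]
    apply E3.ext <;>
      simp only [bloch_apply_zero, bloch_apply_one, bloch_apply_two, ketBra,
        Matrix.vecMulVec_apply, Pi.star_apply, Matrix.cons_val_zero, Matrix.cons_val_one,
        Matrix.cons_val_fin_one, RCLike.star_def, Complex.conj_ofReal, Complex.mul_re,
        Complex.mul_im, Complex.ofReal_re, Complex.ofReal_im, Matrix.cons_val]
    · field_simp
      rw [h2]
      linear_combination -2 * Real.sin (φ / 2) ^ 2 * hi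
    · ring
    · field_simp
      rw [h2]
      ring

lemma dephasing_planar (p x z : ℝ) : dephasing p (planar x z) = planar ((1 - 2 * p) * x) z := by
  ext i j
  fin_cases i <;> fin_cases j <;> simp [dephasing, planar, pauliZ] <;> ring

lemma planarProblem_dephasing {p θbar : ℝ} {ρ τ : Fin 2 → Qubit} (hp0 : 0 < p) (hp1 : p ≤ 1 / 2)
    (hθ0 : 0 < θbar) (hθ1 : θbar < Real.pi / 2) (hτ : ∀ i, τ i = ketBra (prepared θbar i))
    (hρ : ∀ i, ρ i = dephasing p (τ i)) :
    PlanarProblem ((1 - 2 * p) * Real.cos θbar) (Real.sin θbar) (Real.cos θbar) (Real.sin θbar)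
      ρ τ := by
  have hτ' : τ = fun i => planar (Real.cos θbar) (sgn i * Real.sin θbar) :=
    funext fun i => by rw [hτ, ketBra_prepared]
  have hρ' : ρ = fun i => planar ((1 - 2 * p) * Real.cos θbar) (sgn i * Real.sin θbar) :=
    funext fun i => by rw [hρ, hτ', dephasing_planar]
  have hc := Real.cos_nonneg_of_mem_Icc (x := θbar) ⟨by linarith [Real.pi_pos], hθ1.le⟩
  have hs := Real.sin_pos_of_pos_of_lt_pi hθ0 (by linarith [Real.pi_pos])
  rw [hρ', hτ']
  exact
    { a_nonneg := mul_nonneg (by linarith) hc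
      a_lt_one := by nlinarith [Real.cos_le_one θbar]
      b_pos := hs
      c_nonneg := hc
      s_nonneg := hs.le
      sq_add_sq := Real.cos_sq_add_sin_sq _
      src_isHermitian := fun _ => isHermitian_planar _ _
      src_trace := fun _ => trace_planar _ _
      tgt_isHermitian := fun _ => isHermitian_planar _ _
      tgt_trace := fun _ => trace_planar _ _
      src_gram := isGram_planar _ _
      tgt_gram := isGram_planar _ _ }

end QubitTracking

open QubitTracking
theorem mainTheorem4 :
    (∀ (R θ θbar : ℝ) (ρ τ : Fin 2 → Qubit),
      0 < R → R < 1 → 0 < θ → θ ≤ Real.pi / 2 → 0 ≤ θbar → θbar ≤ Real.pi / 2 →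
      (∀ i, IsDensity (ρ i)) → (∀ i, ‖bloch (ρ i)‖ = R) →
      InnerProductGeometry.angle (bloch (ρ 0)) (bloch (ρ 1)) = 2 * θ →
      (∀ i, IsPureState (τ i)) →
      InnerProductGeometry.angle (bloch (τ 0)) (bloch (τ 1)) = 2 * θbar →
      Omega equalPriority ρ τ
          = 2 * (Real.cos θbar ^ 2
              - R ^ 2 * Real.cos θ * Real.cos θbar * Real.cos (θ - θbar)) ∧
      (0 < Omega equalPriority ρ τ →
        IsGreatest (achievable equalPriority ρ τ)
          (1 / 2 + 1 / 2 * √(Real.cos θbar ^ 2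
            + R ^ 2 * Real.sin θ ^ 2 * Real.sin θbar ^ 2 / (1 - R ^ 2 * Real.cos θ ^ 2))) ∧
        (∃ C ∈ cptp, IsProcedureA equalPriority ρ τ C) ∧
        ∀ C ∈ cptp, IsProcedureA equalPriority ρ τ C → IsOptimal equalPriority ρ τ C) ∧
      (Omega equalPriority ρ τ ≤ 0 →
        IsGreatest (achievable equalPriority ρ τ) (1 / 2 + 1 / 2 * (R * Real.cos (θ - θbar))) ∧
        ∃ C, IsUnitaryOperation C ∧ IsOptimal equalPriority ρ τ C)) ∧
    (∀ (p θbar : ℝ) (ρ τ : Fin 2 → Qubit),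
      0 < p → p ≤ 1 / 2 → 0 < θbar → θbar < Real.pi / 2 →
      (∀ i, τ i = ketBra (prepared θbar i)) →
      (∀ i, ρ i = dephasing p (τ i)) →
      Omega equalPriority ρ τ
          = 2 * Real.cos θbar ^ 2
              * (1 - ‖bloch (ρ 0)‖ ^ 2 + 2 * p * Real.sin θbar ^ 2) ∧
      0 < Omega equalPriority ρ τ ∧
      IsGreatest (achievable equalPriority ρ τ)
        (1 / 2 + 1 / 2 * √(Real.cos θbar ^ 2
          + Real.sin θbar ^ 4 / (1 - (1 - 2 * p) ^ 2 * Real.cos θbar ^ 2))) ∧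
      (∃ C ∈ cptp, IsProcedureA equalPriority ρ τ C) ∧
      ∀ C ∈ cptp, IsProcedureA equalPriority ρ τ C → IsOptimal equalPriority ρ τ C) := by
  refine ⟨?_, ?_⟩
  · intro R θ θbar ρ τ hR0 hR1 hθ0 hθ1 hθb0 hθb1 hρ hn hang hτ hangb
    have h := planarProblem_of_angles hR0 hR1 hθ0 hθ1 hθb0 hθb1 hρ hn hang hτ hangb
    refine ⟨?_, fun hΩ => ?_, fun hΩ => ?_⟩
    · rw [h.Omega_eq, Real.cos_sub]
      ring
    · have hval : optValue (R * Real.cos θ) (R * Real.sin θ) (Real.cos θbar) (Real.sin θbar)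
          = √(Real.cos θbar ^ 2
            + R ^ 2 * Real.sin θ ^ 2 * Real.sin θbar ^ 2 / (1 - R ^ 2 * Real.cos θ ^ 2)) := by
        simp only [optValue, mul_pow]
      rw [← hval]
      exact h.isGreatest_of_pos hΩ
    · have hval : R * Real.cos (θ - θbar)
          = R * Real.cos θ * Real.cos θbar + R * Real.sin θ * Real.sin θbar := by
        rw [Real.cos_sub]
        ring
      rw [hval]
      exact h.isGreatest_of_nonpos hΩ
  · intro p θbar ρ τ hp0 hp1 hθ0 hθ1 hτ hρ
    have h := planarProblem_dephasing hp0 hp1 hθ0 hθ1 hτ hρ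
    have hR : ‖bloch (ρ 0)‖ ^ 2 = ((1 - 2 * p) * Real.cos θbar) ^ 2 + Real.sin θbar ^ 2 :=
      h.src_gram.norm_sq 0
    have hΩ : Omega equalPriority ρ τ = 2 * Real.cos θbar ^ 2
        * (1 - ‖bloch (ρ 0)‖ ^ 2 + 2 * p * Real.sin θbar ^ 2) := by
      rw [h.Omega_eq, hR]
      ring
    have hpos : 0 < Omega equalPriority ρ τ := by
      have hc : 0 < Real.cos θbar :=
        Real.cos_pos_of_mem_Ioo ⟨by linarith [Real.pi_pos], hθ1⟩
      have hR1 : 1 - ‖bloch (ρ 0)‖ ^ 2 = 4 * p * (1 - p) * Real.cos θbar ^ 2 := by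
        rw [hR]
        linear_combination -Real.sin_sq_add_cos_sq θbar
      have hp : 0 < 1 - p := by linarith
      rw [hΩ, hR1]
      positivity
    have hval : optValue ((1 - 2 * p) * Real.cos θbar) (Real.sin θbar) (Real.cos θbar)
        (Real.sin θbar) = √(Real.cos θbar ^ 2
          + Real.sin θbar ^ 4 / (1 - (1 - 2 * p) ^ 2 * Real.cos θbar ^ 2)) := by
      simp only [optValue, mul_pow]
      ring_nf
    rw [← hval]
    exact ⟨hΩ, hpos, h.isGreatest_of_pos hpos⟩
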